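/- **Setting.** Let $\alpha\in(0,2)$ and $a,b\in(0,+\infty)$. Let $(X_{i,j})_{i\le j}$ be independent random variables on a probability space such that the $X_{i,j}$, $i<j$, are complex-valued and identically distributed with $\mathbb E X_{1,2}=0$ and $\mathbb E|X_{1,2}|^2=1$, and the $X_{i,i}$ are real-valued and identically distributed; put $X_{j,i}=\overline{X_{i,j}}$. Assume that $\Re X_{1,2}$ and $\Im X_{1,2}$ are independent, that $$\lim_{t\to+\infty}-t^{-\alpha}\log\mathbb P(|X_{1,1}|>t)=b,\qquad \lim_{t\to+\infty}-t^{-\alpha}\log\mathbb P(|X_{1,2}|>t)=a,$$ and that there are probability measures $\nu_1,\nu_2$ on the unit circle $\mathbb S^1$ and $t_0>0$ such that for all $t\ge t_0$ and all measurable $U\subset\mathbb S^1$, $$\mathbb P\big(X_{1,1}/|X_{1,1}|\in U,\ |X_{1,1}|\ge t\big)=\nu_1(U)\,\mathbb P(|X_{1,1}|\ge t),\qquad \mathbb P\big(X_{1,2}/|X_{1,2}|\in U,\ |X_{1,2}|\ge t\big)=\nu_2(U)\,\mathbb P(|X_{1,2}|\ge t).$$ For $\varepsilon>0$ and $N\ge1$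 let $C^\varepsilon$ be the $N\times N$ Hermitian matrix with entries $$C^\varepsilon_{i,j}=\mathbf 1_{\varepsilon N^{1/2}\le |X_{i,j}|_\infty\le\varepsilon^{-1}N^{1/2}}\,\frac{X_{i,j}}{\sqrt N},\qquad |z|_\infty=\max(|\Re z|,|\Im z|).$$ For $r\in\mathbb N$ let $\mathcal E_r$ be the set of Hermitian matrices $A$ of arbitrary finite size (matrices that differ by padding with zeros being identified) with at most $r$ nonzero entries, i.e. $\mathrm{Card}\{(i,j):A_{i,j}\ne0\}\le r$. Let $\mathcal S=\bigcup_n\mathcal S_n$ act on $\mathcal E_r$ by $(\sigma.A)_{i,j}=A_{\sigma(i),\sigma(j)}$, let $\widetilde{\mathcal E}_r$ be the set of equivalence classes and $\pi:\mathcal E_r\to\widetilde{\mathcal E}_r$ the projection. Equip $\widetilde{\mathcal E}_r$ with the distance $$\tilde d(\tilde A,\tilde B)=\min_{\sigma,\sigma'\in\mathcal S}\max_{i,j}\big|B_{\sigma(i),\sigma(j)}-A_{\sigma'(i),\sigma'(j)}\big|$$ ($A$, $B$ being representatives of $\tilde A$, $\tilde B$) and its Borel $\sigma$-field. Let $\widetilde{\mathbb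 P}^\varepsilon_{N,r}$ be the law of $\pi(C^\varepsilon)$ conditionally on $\{C^\varepsilon\in\mathcal E_r\}$ (which is defined for all large $N$). Let $$\mathcal D_{\varepsilon,r}=\Big\{A\in\mathcal E_r:\ \forall i\le j,\ A_{i,j}=0\ \text{ or }\ \big(\varepsilon\le|A_{i,j}|\le\varepsilon^{-1}\text{ and }A_{i,j}/|A_{i,j}|\in\mathrm{supp}(\nu_{i,j})\big)\Big\},$$ with $\nu_{i,j}=\nu_1$ if $i=j$ and $\nu_{i,j}=\nu_2$ if $i<j$. **Proposition.** Let $r\in\mathbb N$ and $\varepsilon>0$ with $\varepsilon\neq1$. Then $(\widetilde{\mathbb P}^\varepsilon_{N,r})_{N}$ satisfies a large deviations principle with speed $N^{\alpha/2}$ and good rate function $$I_{\varepsilon,r}(\tilde A)=\begin{cases} b\sum_{i\ge1}|A_{i,i}|^\alpha+\dfrac a2\sum_{i\ne j}|A_{i,j}|^\alpha&\text{if }\tilde A\text{ has a representative }A\in\mathcal D_{\varepsilon,r},\\ +\infty&\text{otherwise.}\end{cases}$$ That is, $I_{\varepsilon,r}$ is lower semicontinuous, the level sets $\{I_{\varepsilon,r}\le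 t\}$, $t\in[0,+\infty)$, are compact, and for every Borel set $B\subset\widetilde{\mathcal E}_r$, with interior $B^\circ$ and closure $\overline B$, $$-\inf_{B^\circ}I_{\varepsilon,r}\le\liminf_{N\to+\infty}\frac1{N^{\alpha/2}}\log\widetilde{\mathbb P}^\varepsilon_{N,r}(B)\le\limsup_{N\to+\infty}\frac1{N^{\alpha/2}}\log\widetilde{\mathbb P}^\varepsilon_{N,r}(B)\le-\inf_{\overline B}I_{\varepsilon,r}.$$ -/

import Mathlib

open MeasureTheory ProbabilityTheory Filter Topology
open scoped ENNReal NNReal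

namespace WignerLDP

noncomputable section

/-! ## Large deviations principles -/

/-- The measures `μ N` satisfy a large deviations principle with speed `v` and rate function `J`:
`J` is lower semicontinuous, `v` increases to infinity, and for every Borel set `B`
`-inf_{int B} J ≤ liminf (1/v N) log μ N B ≤ limsup (1/v N) log μ N B ≤ -inf_{cl B} J`
(with `log 0 = -∞` and `inf ∅ = +∞`). -/
structure SatisfiesLDP {E : Type*} [TopologicalSpace E] [MeasurableSpace E] [BorelSpace E]
    (μ : ℕ → Measure E) (v : ℕ → ℝ) (J : E → ℝ≥0∞) : Prop where
  lowerSemicontinuous : LowerSemicontinuous J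
  monotone_speed : Monotone v
  tendsto_speed : Tendsto v atTop atTop
  lower_bound : ∀ B : Set E, MeasurableSet B →
    -(((⨅ x ∈ interior B, J x : ℝ≥0∞)) : EReal) ≤
      liminf (fun N => (((v N)⁻¹ : ℝ) : EReal) * ENNReal.log (μ N B)) atTop
  upper_bound : ∀ B : Set E, MeasurableSet B →
    limsup (fun N => (((v N)⁻¹ : ℝ) : EReal) * ENNReal.log (μ N B)) atTop ≤
      -(((⨅ x ∈ closure B, J x : ℝ≥0∞)) : EReal)

/-- A rate function is good if all its level sets are compact. -/
def IsGood {E : Type*} [TopologicalSpace E] (J : E → ℝ≥0∞) : Prop :=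
  ∀ t : ℝ≥0, IsCompact {x | J x ≤ t}

/-! ## Wigner matrices and the assumption on the tails -/

/-- `(X i j)` is a Wigner array: all variables `X i j` with `i ≤ j` are independent, those with
`i < j` are identically distributed, centred with `E|X 0 1|² = 1`, the diagonal ones are
identically distributed, and `X j i` is the conjugate of `X i j` (so the diagonal is real).
Rows and columns are numbered from `0`. -/
structure IsWigner {Ω : Type*} [MeasurableSpace Ω] (P : Measure Ω) (X : ℕ → ℕ → Ω → ℂ) :
    Prop where
  measurable : ∀ i j, Measurable (X i j)
  hermitian : ∀ i j ω, X j i ω = star (X i j ω)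
  indep : iIndepFun (fun p : {p : ℕ × ℕ // p.1 ≤ p.2} => X p.1.1 p.1.2) P
  identDistrib_diag : ∀ i, IdentDistrib (X i i) (X 0 0) P P
  identDistrib_off : ∀ i j, i < j → IdentDistrib (X i j) (X 0 1) P P
  mean_zero : ∫ ω, X 0 1 ω ∂P = 0
  variance_one : ∫ ω, ‖X 0 1 ω‖ ^ 2 ∂P = 1

/-- For large values of `|Y|`, the angle `Y / |Y|` has law `ν` and is independent of `|Y|`. -/
def AngleDecoupled {Ω : Type*} [MeasurableSpace Ω] (P : Measure Ω) (Y : Ω → ℂ)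
    (ν : Measure (Metric.sphere (0 : ℂ) 1)) : Prop :=
  ∃ t₀ : ℝ, 0 < t₀ ∧ ∀ t : ℝ, t₀ ≤ t → ∀ U : Set (Metric.sphere (0 : ℂ) 1), MeasurableSet U →
    P {ω | Y ω / (‖Y ω‖ : ℂ) ∈ ((↑) '' U : Set ℂ) ∧ t ≤ ‖Y ω‖} = ν U * P {ω | t ≤ ‖Y ω‖}

/-- `P(|Y| > t) = exp(-(c + o(1)) t^α)` as `t → ∞`. -/
def HasTail {Ω : Type*} [MeasurableSpace Ω] (P : Measure Ω) (Y : Ω → ℂ) (α c : ℝ) : Prop :=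
  Tendsto (fun t : ℝ => -t ^ (-α) * Real.log (P.real {ω | t < ‖Y ω‖})) atTop (𝓝 c)

/-- The standing assumptions on the Wigner array. The independence of the real and imaginary
parts holds automatically when the off-diagonal entries are real. -/
structure TailAssumption {Ω : Type*} [MeasurableSpace Ω] (P : Measure Ω) (X : ℕ → ℕ → Ω → ℂ)
    (α a b : ℝ) (ν₁ ν₂ : Measure (Metric.sphere (0 : ℂ) 1)) : Prop where
  isWigner : IsWigner P X
  indep_re_im : IndepFun (fun ω => (X 0 1 ω).re) (fun ω => (X 0 1 ω).im) P
  α_pos : 0 < α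
  α_lt_two : α < 2
  a_pos : 0 < a
  b_pos : 0 < b
  tail_diag : HasTail P (X 0 0) α b
  tail_off : HasTail P (X 0 1) α a
  angle_diag : AngleDecoupled P (X 0 0) ν₁
  angle_off : AngleDecoupled P (X 0 1) ν₂

/-! ## The matrix `C^ε` -/

/-- `|z|_∞ = max(|Re z|, |Im z|)`. -/
def cInf (z : ℂ) : ℝ := max |z.re| |z.im|

open Classical in
/-- The `N × N` matrix with entries `X i j / √N` if `ε √N ≤ |X i j|_∞ ≤ ε⁻¹ √N` and `0`
otherwise, padded by zeros to an infinite matrix. -/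
def cutMatrix {Ω : Type*} (X : ℕ → ℕ → Ω → ℂ) (ε : ℝ) (N : ℕ) (ω : Ω) : Matrix ℕ ℕ ℂ :=
  fun i j =>
    if (i < N ∧ j < N) ∧ ε * √(N : ℝ) ≤ cInf (X i j ω) ∧ cInf (X i j ω) ≤ ε⁻¹ * √(N : ℝ) then
      X i j ω / (√(N : ℝ) : ℂ)
    else 0

/-! ## Sparse Hermitian matrices modulo permutations -/

/-- The set `E_r` of Hermitian matrices of any finite size, identified when they differ by a
padding with zeros, with at most `r` nonzero entries. -/
def IsSparse (r : ℕ) (A : Matrix ℕ ℕ ℂ) : Prop :=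
  A.IsHermitian ∧ {p : ℕ × ℕ | A p.1 p.2 ≠ 0}.encard ≤ r

/-- `E_r` as a type. -/
structure Sparse (r : ℕ) where
  /-- the infinite matrix -/
  entry : Matrix ℕ ℕ ℂ
  isSparse : IsSparse r entry

/-- The group `S = ⋃ₙ Sₙ` of the permutations that move only finitely many indices. -/
def finPerm : Subgroup (Equiv.Perm ℕ) where
  carrier := {σ | ∃ n, ∀ i, n ≤ i → σ i = i}
  one_mem' := ⟨0, fun _ _ => rfl⟩
  mul_mem' := by
    rintro σ τ ⟨m, hm⟩ ⟨n, hn⟩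
    refine ⟨max m n, fun i hi => ?_⟩
    rw [Equiv.Perm.mul_apply, hn i (le_trans (le_max_right _ _) hi),
      hm i (le_trans (le_max_left _ _) hi)]
  inv_mem' := by
    rintro σ ⟨n, hn⟩
    refine ⟨n, fun i hi => ?_⟩
    rw [Equiv.Perm.inv_eq_iff_eq, hn i hi]

variable {r : ℕ}

/-- The action of permutations: `(σ.A) i j = A (σ i) (σ j)`. -/
def Sparse.perm (σ : finPerm) (A : Sparse r) : Sparse r :=
  ⟨fun i j => A.entry (σ.1 i) (σ.1 j), by
    refine ⟨?_, ?_⟩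
    · ext i j
      exact congrFun (congrFun A.2.1 (σ.1 i)) (σ.1 j)
    · have h := (Equiv.prodCongr σ.1 σ.1).injective.encard_image
        {p : ℕ × ℕ | A.entry (σ.1 p.1) (σ.1 p.2) ≠ 0}
      rw [← h]
      refine le_trans (Set.encard_le_encard ?_) A.2.2
      rintro _ ⟨p, hp, rfl⟩
      exact hp⟩

lemma Sparse.perm_perm (σ τ : finPerm) (A : Sparse r) :
    (A.perm σ).perm τ = A.perm (σ * τ) := rfl

lemma Sparse.perm_one (A : Sparse r) : A.perm 1 = A := rfl

/-- Two matrices are equivalent if one is obtained from the other by a permutation. -/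
instance sparseSetoid (r : ℕ) : Setoid (Sparse r) where
  r A B := ∃ σ : finPerm, B = A.perm σ
  iseqv :=
    { refl := fun A => ⟨1, rfl⟩
      symm := by
        rintro A _ ⟨σ, rfl⟩
        exact ⟨σ⁻¹, by rw [Sparse.perm_perm, mul_inv_cancel, Sparse.perm_one]⟩
      trans := by
        rintro A _ _ ⟨σ, rfl⟩ ⟨τ, rfl⟩
        exact ⟨σ * τ, rfl⟩ }

/-- The quotient space `Ẽ_r`. -/
def SparseClass (r : ℕ) : Type := Quotient (sparseSetoid r)

/-- The projection `π : E_r → Ẽ_r`. -/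
def proj (A : Sparse r) : SparseClass r := Quotient.mk (sparseSetoid r) A

/-- `max_{i,j} |B i j - A i j|`. -/
def supDist (A B : Sparse r) : ℝ := ⨆ p : ℕ × ℕ, ‖B.entry p.1 p.2 - A.entry p.1 p.2‖

lemma bddAbove_supDist (A B : Sparse r) :
    BddAbove (Set.range fun p : ℕ × ℕ => ‖B.entry p.1 p.2 - A.entry p.1 p.2‖) := by
  have hfin : ∀ A : Sparse r, {p : ℕ × ℕ | A.entry p.1 p.2 ≠ 0}.Finite := fun A =>
    Set.finite_of_encard_le_coe A.2.2
  have hs : ((fun p : ℕ × ℕ => ‖B.entry p.1 p.2 - A.entry p.1 p.2‖) ''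
      ({p | A.entry p.1 p.2 ≠ 0} ∪ {p | B.entry p.1 p.2 ≠ 0})).Finite :=
    ((hfin A).union (hfin B)).image _
  refine (hs.union (Set.finite_singleton 0)).bddAbove.mono ?_
  rintro _ ⟨p, rfl⟩
  by_cases hp : p ∈ {p : ℕ × ℕ | A.entry p.1 p.2 ≠ 0} ∪ {p | B.entry p.1 p.2 ≠ 0}
  · exact Or.inl ⟨p, hp, rfl⟩
  · right
    simp only [Set.mem_union, Set.mem_ofPred_eq, not_or, not_not] at hp
    simp [hp.1, hp.2]

lemma supDist_nonneg (A B : Sparse r) : 0 ≤ supDist A B :=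
  Real.iSup_nonneg fun _ => norm_nonneg _

lemma supDist_self (A : Sparse r) : supDist A A = 0 := by simp [supDist]

lemma supDist_comm (A B : Sparse r) : supDist A B = supDist B A := by
  simp only [supDist, norm_sub_rev]

lemma supDist_triangle (A B C : Sparse r) : supDist A C ≤ supDist A B + supDist B C := by
  refine ciSup_le fun p => ?_
  have h1 : _ ≤ supDist A B := le_ciSup (bddAbove_supDist A B) p
  have h2 : _ ≤ supDist B C := le_ciSup (bddAbove_supDist B C) p
  have h3 := norm_sub_le_norm_sub_add_norm_sub (C.entry p.1 p.2) (B.entry p.1 p.2) (A.entry p.1 p.2)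
  linarith

lemma supDist_perm (σ : finPerm) (A B : Sparse r) :
    supDist (A.perm σ) (B.perm σ) = supDist A B :=
  (Equiv.prodCongr σ.1 σ.1).iSup_comp (g := fun p : ℕ × ℕ => ‖B.entry p.1 p.2 - A.entry p.1 p.2‖)

/-- `min_{σ,σ'} max_{i,j} |B (σ i) (σ j) - A (σ' i) (σ' j)|`. -/
def orbitDist (A B : Sparse r) : ℝ :=
  ⨅ s : finPerm × finPerm, supDist (A.perm s.2) (B.perm s.1)

lemma bddBelow_orbitDist (A B : Sparse r) :
    BddBelow (Set.range fun s : finPerm × finPerm => supDist (A.perm s.2) (B.perm s.1)) :=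
  ⟨0, by rintro _ ⟨s, rfl⟩; exact supDist_nonneg _ _⟩

lemma orbitDist_self (A : Sparse r) : orbitDist A A = 0 := by
  refine le_antisymm ?_ (Real.iInf_nonneg fun _ => supDist_nonneg _ _)
  exact (ciInf_le (bddBelow_orbitDist A A) (1, 1)).trans (supDist_self _).le

lemma orbitDist_comm_le (A B : Sparse r) : orbitDist A B ≤ orbitDist B A := by
  refine le_ciInf fun s => ?_
  rw [supDist_comm]
  exact ciInf_le (bddBelow_orbitDist A B) (s.2, s.1)

lemma orbitDist_triangle (A B C : Sparse r) :
    orbitDist A C ≤ orbitDist A B + orbitDist B C := by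
  refine le_ciInf_add_ciInf fun s t => ?_
  have h : (B.perm t.2).perm (t.2⁻¹ * s.1) = B.perm s.1 := by
    rw [Sparse.perm_perm, mul_inv_cancel_left]
  have h1 : orbitDist A C ≤ supDist (A.perm s.2) (C.perm (t.1 * (t.2⁻¹ * s.1))) :=
    ciInf_le (bddBelow_orbitDist A C) (t.1 * (t.2⁻¹ * s.1), s.2)
  have h2 := supDist_triangle (A.perm s.2) (B.perm s.1) (C.perm (t.1 * (t.2⁻¹ * s.1)))
  have h3 := supDist_perm (t.2⁻¹ * s.1) (B.perm t.2) (C.perm t.1)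
  rw [h, Sparse.perm_perm] at h3
  exact h1.trans (h2.trans (add_le_add le_rfl h3.le))

lemma orbitDist_perm (σ : finPerm) (A : Sparse r) : orbitDist A (A.perm σ) = 0 := by
  refine le_antisymm ?_ (Real.iInf_nonneg fun _ => supDist_nonneg _ _)
  exact (ciInf_le (bddBelow_orbitDist A (A.perm σ)) (1, σ)).trans (supDist_self _).le

/-- The distance `d̃` on `Ẽ_r`, which defines its topology. -/
instance : PseudoMetricSpace (SparseClass r) where
  dist x y := Quotient.liftOn₂ x y orbitDist (by
    rintro A B _ _ ⟨σ, rfl⟩ ⟨τ, rfl⟩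
    have h := orbitDist_perm σ A
    have h' := orbitDist_perm τ B
    have c := orbitDist_comm_le (A.perm σ) A
    have c' := orbitDist_comm_le (B.perm τ) B
    have t1 := orbitDist_triangle A (A.perm σ) B
    have t2 := orbitDist_triangle (A.perm σ) (B.perm τ) B
    have t3 := orbitDist_triangle (A.perm σ) A (B.perm τ)
    have t4 := orbitDist_triangle A B (B.perm τ)
    linarith)
  dist_self := by rintro ⟨A⟩; exact orbitDist_self A
  dist_comm := by
    rintro ⟨A⟩ ⟨B⟩
    exact le_antisymm (orbitDist_comm_le A B) (orbitDist_comm_le B A)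
  dist_triangle := by rintro ⟨A⟩ ⟨B⟩ ⟨C⟩; exact orbitDist_triangle A B C

/-- `Ẽ_r` carries its Borel σ-algebra. -/
instance : MeasurableSpace (SparseClass r) := borel _

instance : BorelSpace (SparseClass r) := ⟨rfl⟩

lemma isSparse_zero (r : ℕ) : IsSparse r 0 :=
  ⟨Matrix.isHermitian_zero, by simp⟩

/-! ## The conditional laws and the rate function -/

/-- The event `{C^ε ∈ E_r}`. -/
def sparseEvent {Ω : Type*} (X : ℕ → ℕ → Ω → ℂ) (ε : ℝ) (r N : ℕ) : Set Ω :=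
  {ω | IsSparse r (cutMatrix X ε N ω)}

open Classical in
/-- The random element `π(C^ε)` of `Ẽ_r` on the event `{C^ε ∈ E_r}`; its (arbitrary) value off this
event plays no role below. -/
def sparseCut {Ω : Type*} (X : ℕ → ℕ → Ω → ℂ) (ε : ℝ) (r N : ℕ) (ω : Ω) : SparseClass r :=
  if h : IsSparse r (cutMatrix X ε N ω) then proj ⟨cutMatrix X ε N ω, h⟩
  else proj ⟨0, isSparse_zero r⟩

/-- The law on `Ẽ_r` of `π(C^ε)` conditionally on `{C^ε ∈ E_r}`. -/
def condLaw {Ω : Type*} [MeasurableSpace Ω] (P : Measure Ω) (X : ℕ → ℕ → Ω → ℂ)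
    (ε : ℝ) (r N : ℕ) : Measure (SparseClass r) :=
  (P[|sparseEvent X ε r N]).map (sparseCut X ε r N)

/-- `b ∑_i |A i i|^α + (a/2) ∑_{i ≠ j} |A i j|^α` (only finitely many terms are nonzero). -/
def energy (α a b : ℝ) (A : Sparse r) : ℝ≥0∞ :=
  ENNReal.ofReal b * ∑' i : ℕ, ‖A.entry i i‖ₑ ^ α +
    ENNReal.ofReal (a / 2) * ∑' p : {p : ℕ × ℕ // p.1 ≠ p.2}, ‖A.entry p.1.1 p.1.2‖ₑ ^ α

lemma energy_perm (α a b : ℝ) (σ : finPerm) (A : Sparse r) :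
    energy α a b (A.perm σ) = energy α a b A := by
  have h1 : ∑' i : ℕ, ‖(A.perm σ).entry i i‖ₑ ^ α = ∑' i : ℕ, ‖A.entry i i‖ₑ ^ α :=
    σ.1.tsum_eq fun i => ‖A.entry i i‖ₑ ^ α
  have h2 : ∑' p : {p : ℕ × ℕ // p.1 ≠ p.2}, ‖(A.perm σ).entry p.1.1 p.1.2‖ₑ ^ α =
      ∑' p : {p : ℕ × ℕ // p.1 ≠ p.2}, ‖A.entry p.1.1 p.1.2‖ₑ ^ α :=
    ((Equiv.prodCongr σ.1 σ.1).subtypeEquiv (p := fun p : ℕ × ℕ => p.1 ≠ p.2)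
      (q := fun p : ℕ × ℕ => p.1 ≠ p.2) (by simp)).tsum_eq
      fun p : {p : ℕ × ℕ // p.1 ≠ p.2} => ‖A.entry p.1.1 p.1.2‖ₑ ^ α
  unfold energy
  rw [h1, h2]

/-- `energy` on equivalence classes, computed on any representative. -/
def classEnergy (α a b : ℝ) (x : SparseClass r) : ℝ≥0∞ :=
  Quotient.liftOn x (energy α a b) (by
    rintro A _ ⟨σ, rfl⟩
    exact (energy_perm α a b σ A).symm)

/-- An admissible value of an entry: `0`, or of modulus in `[ε, ε⁻¹]` with angle in the support
of `ν`. -/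
def AdmissibleEntry (ε : ℝ) (ν : Measure (Metric.sphere (0 : ℂ) 1)) (z : ℂ) : Prop :=
  z = 0 ∨ ((ε ≤ ‖z‖ ∧ ‖z‖ ≤ ε⁻¹) ∧ z / (‖z‖ : ℂ) ∈ ((↑) '' ν.support : Set ℂ))

/-- The admissible domain `𝒟_{ε,r}`. -/
def domain (ε : ℝ) (ν₁ ν₂ : Measure (Metric.sphere (0 : ℂ) 1)) (r : ℕ) : Set (Sparse r) :=
  {A | (∀ i, AdmissibleEntry ε ν₁ (A.entry i i)) ∧ ∀ i j, i < j → AdmissibleEntry ε ν₂ (A.entry i j)}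

open Classical in
/-- The rate function on `Ẽ_r`: finite exactly on the classes with a representative in
`𝒟_{ε,r}`. -/
def rate (α a b ε : ℝ) (ν₁ ν₂ : Measure (Metric.sphere (0 : ℂ) 1)) (r : ℕ) (x : SparseClass r) : ℝ≥0∞ :=
  if x ∈ proj '' domain ε ν₁ ν₂ r then classEnergy α a b x else ⊤

end

end WignerLDP

namespace WignerLDP

/-! ## Finitely supported permutations -/

/-! At speed `N ^ (α / 2)` only entries of size of order `√N` matter: the event `s * √N ≤ ‖X i j‖`
has probability `exp(-(c + o(1)) s ^ α N ^ (α / 2))`, with `c = b` on the diagonal and `c = a` off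
it. By independence, producing the nonzero entries of `A` costs the sum of these exponents over the
upper triangle, which is the energy of `A`. Choosing the positions contributes only a factor
polynomial in `N`, and forcing every other entry to be cut to `0` costs at most a factor `1 / 2` for
large `N`.

The angles need a separate argument. The diagonal is real, and off the diagonal the independence of
real and imaginary parts together with `α < 2` forces the limiting angle onto the coordinate axes
(`AngleDecoupled.axisPoints_of_indep`): a large value in an oblique direction would require two
independent large coordinates, which is strictly more expensive. On the axes `cInf` equals the
modulus, so the cut-off made with `cInf` leaves almost surely, for large `N`, only admissible
entries (`TailAssumption.ae_sparseCut_mem`).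

The core is a pair of local estimates around the class of an admissible matrix:
`TailAssumption.eventually_near_ge` and `TailAssumption.exists_eventually_near_le`. The first one at
`A = 0` shows that the conditioning event is not exponentially unlikely, so both estimates pass to
the conditional laws. The lower bound for a set follows from a single ball around a point of its
interior. For the upper bound, the classes meeting the domain form a compact set, since each has a
representative in an `r × r` block with bounded entries; finitely many balls cover the relevant part
of the closure, and the remaining classes have mass `0` for large `N`. -/

lemma swap_mem_finPerm (a b : ℕ) : Equiv.swap a b ∈ finPerm :=
  ⟨max a b + 1, fun i hi => Equiv.swap_apply_of_ne_of_ne (by omega) (by omega)⟩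

/-- An injective map on a finite set of indices extends to a finitely supported permutation. -/
lemma exists_finPerm_eqOn (f : ℕ → ℕ) (T : Finset ℕ) (hf : Set.InjOn f T) :
    ∃ σ : finPerm, ∀ k ∈ T, σ.1 k = f k := by
  induction T using Finset.induction_on with
  | empty => exact ⟨1, by simp⟩
  | insert a T ha ih =>
    obtain ⟨σ, hσ⟩ := ih (hf.mono (by simp))
    -- Post-composing with this transposition corrects the value at `a`. The earlier values are
    -- untouched: they differ from `σ a` because `σ` is injective and from `f a` because `f` is.
    refine ⟨⟨Equiv.swap (σ.1 a) (f a), swap_mem_finPerm _ _⟩ * σ, fun k hk => ?_⟩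
    change Equiv.swap (σ.1 a) (f a) (σ.1 k) = f k
    rcases Finset.mem_insert.1 hk with rfl | hk'
    · simp
    · have hka : k ≠ a := fun h => ha (h ▸ hk')
      rw [Equiv.swap_apply_of_ne_of_ne (fun h => hka (σ.1.injective h)), hσ k hk']
      rw [hσ k hk']
      exact fun h => hka (hf hk (by simp) h)

/-! ## Sparse matrices -/

variable {r : ℕ}

@[ext]
lemma Sparse.ext {A B : Sparse r} (h : ∀ i j, A.entry i j = B.entry i j) : A = B := by
  cases A; cases B
  congr
  ext i j
  exact h i j

lemma Sparse.entry_swap (A : Sparse r) (i j : ℕ) : A.entry j i = star (A.entry i j) :=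
  (A.isSparse.1.apply j i).symm

lemma Sparse.norm_entry_swap (A : Sparse r) (i j : ℕ) : ‖A.entry j i‖ = ‖A.entry i j‖ := by
  rw [A.entry_swap, norm_star]

lemma Sparse.entry_swap_ne_zero (A : Sparse r) {i j : ℕ} :
    A.entry j i ≠ 0 ↔ A.entry i j ≠ 0 := by
  rw [← norm_ne_zero_iff, A.norm_entry_swap, norm_ne_zero_iff]

lemma Sparse.finite_support (A : Sparse r) : {p : ℕ × ℕ | A.entry p.1 p.2 ≠ 0}.Finite :=
  Set.finite_of_encard_le_coe A.2.2

/-- This turns suprema over positions and infima over the infinite permutation group into maxima and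
minima: the distances only take values in a finite set of norms of differences. -/
lemma Sparse.finite_values (A : Sparse r) :
    (Set.range fun p : ℕ × ℕ => A.entry p.1 p.2).Finite := by
  refine ((A.finite_support.image fun p => A.entry p.1 p.2).union
    (Set.finite_singleton 0)).subset ?_
  rintro _ ⟨p, rfl⟩
  by_cases hp : A.entry p.1 p.2 = 0
  · exact Or.inr hp
  · exact Or.inl ⟨p, hp, rfl⟩

lemma exists_supDist_eq (A B : Sparse r) :
    ∃ p : ℕ × ℕ, supDist A B = ‖B.entry p.1 p.2 - A.entry p.1 p.2‖ := by
  have hfin : (Set.range fun p : ℕ × ℕ => ‖B.entry p.1 p.2 - A.entry p.1 p.2‖).Finite := by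
    refine ((B.finite_values.prod A.finite_values).image fun q => ‖q.1 - q.2‖).subset ?_
    rintro _ ⟨p, rfl⟩
    exact ⟨(B.entry p.1 p.2, A.entry p.1 p.2), ⟨⟨p, rfl⟩, ⟨p, rfl⟩⟩, rfl⟩
  obtain ⟨p, hp⟩ := (Set.range_nonempty _).csSup_mem hfin
  exact ⟨p, hp.symm⟩

lemma norm_sub_le_supDist (A B : Sparse r) (i j : ℕ) :
    ‖B.entry i j - A.entry i j‖ ≤ supDist A B :=
  le_ciSup (bddAbove_supDist A B) (i, j)

/-- The minimum in the definition of the orbit distance is attained. -/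
lemma exists_orbitDist_eq (A B : Sparse r) :
    ∃ s : finPerm × finPerm, orbitDist A B = supDist (A.perm s.2) (B.perm s.1) := by
  have hfin : (Set.range fun s : finPerm × finPerm =>
      supDist (A.perm s.2) (B.perm s.1)).Finite := by
    refine ((B.finite_values.prod A.finite_values).image fun q => ‖q.1 - q.2‖).subset ?_
    rintro _ ⟨s, rfl⟩
    obtain ⟨p, hp⟩ := exists_supDist_eq (A.perm s.2) (B.perm s.1)
    exact ⟨(B.entry (s.1.1 p.1) (s.1.1 p.2), A.entry (s.2.1 p.1) (s.2.1 p.2)),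
      ⟨⟨(s.1.1 p.1, s.1.1 p.2), rfl⟩, ⟨(s.2.1 p.1, s.2.1 p.2), rfl⟩⟩, hp.symm⟩
  obtain ⟨s, hs⟩ := (Set.range_nonempty _).csInf_mem hfin
  exact ⟨s, hs.symm⟩

lemma orbitDist_le_supDist (A B : Sparse r) : orbitDist A B ≤ supDist A B :=
  ciInf_le (bddBelow_orbitDist A B) (1, 1)

lemma dist_proj (A B : Sparse r) : dist (proj A) (proj B) = orbitDist A B := rfl

lemma proj_perm (σ : finPerm) (A : Sparse r) : proj (A.perm σ) = proj A :=
  (Quotient.sound ⟨σ, rfl⟩ : proj A = proj (A.perm σ)).symm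

lemma proj_surjective (x : SparseClass r) : ∃ A : Sparse r, proj A = x :=
  Quotient.exists_rep x

/-- Since the minimum over permutations is attained, distance zero makes two relabelled matrices
equal. Separation is what makes compact level sets closed. -/
instance : T2Space (SparseClass r) := by
  have : T0Space (SparseClass r) := by
    refine ⟨fun x y hxy => ?_⟩
    obtain ⟨A, rfl⟩ := proj_surjective x
    obtain ⟨B, rfl⟩ := proj_surjective y
    have h0 := Metric.inseparable_iff.1 hxy
    rw [dist_proj] at h0
    obtain ⟨s, hs⟩ := exists_orbitDist_eq A B
    have : A.perm s.2 = B.perm s.1 := by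
      ext i j
      have h := norm_sub_le_supDist (A.perm s.2) (B.perm s.1) i j
      rw [← hs, h0, norm_le_zero_iff, sub_eq_zero] at h
      exact h.symm
    rw [← proj_perm s.2 A, this, proj_perm]
  infer_instance

/-- If `π(C)` is close to `π(A)`, then `C` is close to `A` after an injective relabelling. -/
lemma exists_relabelling {A C : Sparse r} {δ : ℝ} (h : dist (proj C) (proj A) < δ) :
    ∃ g : ℕ → ℕ, g.Injective ∧ ∀ i j, ‖C.entry (g i) (g j) - A.entry i j‖ < δ := by
  rw [dist_comm, dist_proj] at h
  obtain ⟨s, hs⟩ := exists_orbitDist_eq A C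
  refine ⟨fun i => s.1.1 (s.2.1⁻¹ i), s.1.1.injective.comp (Equiv.injective _), fun i j => ?_⟩
  have h1 := norm_sub_le_supDist (A.perm s.2) (C.perm s.1) (s.2.1⁻¹ i) (s.2.1⁻¹ j)
  rw [← hs] at h1
  refine lt_of_le_of_lt ?_ h
  simpa [Sparse.perm] using h1

/-- `A` vanishes outside the block of the first `n` rows and columns. -/
def InBlock (n : ℕ) (A : ℕ → ℕ → ℂ) : Prop := ∀ i j, n ≤ i ∨ n ≤ j → A i j = 0

/-- By Hermitian symmetry the nonzero rows are also the nonzero columns, and there are no more of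
them than nonzero entries. -/
lemma Sparse.exists_rows (A : Sparse r) :
    ∃ R : Finset ℕ, R.card ≤ r ∧ (∀ i j, A.entry i j ≠ 0 → i ∈ R ∧ j ∈ R) ∧
      ∀ i ∈ R, ∃ j, A.entry i j ≠ 0 := by
  classical
  refine ⟨A.finite_support.toFinset.image Prod.fst, ?_, fun i j h => ⟨?_, ?_⟩, fun i hi => ?_⟩
  · refine Finset.card_image_le.trans ?_
    have := A.2.2
    rw [A.finite_support.encard_eq_coe_toFinset_card] at this
    exact_mod_cast this
  · exact Finset.mem_image.2 ⟨(i, j), by simpa using h, rfl⟩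
  · exact Finset.mem_image.2 ⟨(j, i), by simpa using A.entry_swap_ne_zero.2 h, rfl⟩
  · obtain ⟨⟨i', j⟩, hp, rfl⟩ := Finset.mem_image.1 hi
    exact ⟨j, by simpa using hp⟩

/-- Every sparse matrix can be relabelled into the first `r` rows and columns, without changing
the order of its nonzero rows. -/
lemma Sparse.exists_perm_inBlock (A : Sparse r) :
    ∃ σ : finPerm, InBlock r (A.perm σ).entry ∧ ∀ i j, i < j → j < r → σ.1 i < σ.1 j := by
  obtain ⟨R, hR, hA, -⟩ := A.exists_rows
  -- The nonzero rows are padded to exactly `r` indices so that the increasing enumeration of `S`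
  -- can serve as relabelling. Being increasing, it keeps upper-triangular positions in the upper
  -- triangle, where `domain` constrains the angles.
  obtain ⟨S, hRS, hS⟩ := Infinite.exists_superset_card_eq R r hR
  set e := S.orderEmbOfFin hS
  let f : ℕ → ℕ := fun k => if h : k < r then e ⟨k, h⟩ else 0
  have hfe : ∀ k (h : k < r), f k = e ⟨k, h⟩ := fun k h => by simp [f, h]
  obtain ⟨σ, hσ⟩ := exists_finPerm_eqOn f (Finset.range r) (by
    intro i hi j hj hij
    simp only [Finset.coe_range, Set.mem_Iio] at hi hj
    rw [hfe i hi, hfe j hj] at hij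
    simpa using e.injective hij)
  have hσ' : ∀ k (h : k < r), σ.1 k = e ⟨k, h⟩ := fun k h => by
    rw [hσ k (by simpa using h), hfe k h]
  have hmem : ∀ k, σ.1 k ∈ R → k < r := by
    intro k hk
    obtain ⟨l, hl⟩ : σ.1 k ∈ Set.range e := by
      rw [Finset.range_orderEmbOfFin]; exact hRS hk
    have : σ.1 k = σ.1 l := by rw [hσ' l l.2]; exact hl.symm
    rw [σ.1.injective this]
    exact l.2
  refine ⟨σ, fun i j hij => ?_, fun i j hij hj => ?_⟩
  · by_contra h
    obtain ⟨h1, h2⟩ := hA _ _ h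
    have := hmem i h1
    have := hmem j h2
    omega
  · rw [hσ' i (hij.trans hj), hσ' j hj]
    exact e.strictMono hij

/-- A class meeting the domain has a representative in the domain supported in the first `r` rows
and columns. -/
lemma exists_rep_inBlock {ε : ℝ} {ν₁ ν₂ : Measure (Metric.sphere (0 : ℂ) 1)} {x : SparseClass r}
    (hx : x ∈ proj '' domain ε ν₁ ν₂ r) :
    ∃ A ∈ domain ε ν₁ ν₂ r, InBlock r A.entry ∧ proj A = x := by
  obtain ⟨A, hA, rfl⟩ := hx
  obtain ⟨σ, h1, h2⟩ := A.exists_perm_inBlock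
  refine ⟨A.perm σ, ⟨fun i => hA.1 _, fun i j hij => ?_⟩, h1, proj_perm _ _⟩
  by_cases hj : j < r
  · exact hA.2 _ _ (h2 i j hij hj)
  · exact Or.inl (h1 i j (Or.inr (not_lt.1 hj)))

/-! ## The energy as a finite sum -/

/-- The pairs `i ≤ j < n`. -/
def upperPairs (n : ℕ) : Finset (ℕ × ℕ) :=
  (Finset.range n ×ˢ Finset.range n).filter fun p => p.1 ≤ p.2

lemma mem_upperPairs {n : ℕ} {p : ℕ × ℕ} : p ∈ upperPairs n ↔ p.1 ≤ p.2 ∧ p.2 < n := by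
  simp only [upperPairs, Finset.mem_filter, Finset.mem_product, Finset.mem_range]
  omega

lemma card_upperPairs_le (n : ℕ) : (upperPairs n).card ≤ n ^ 2 := by
  refine (Finset.card_filter_le _ _).trans ?_
  simp [sq]

/-- The exponent of the tail of the entry in position `p`. -/
def tailWeight (a b : ℝ) (p : ℕ × ℕ) : ℝ := if p.1 = p.2 then b else a

/-- `b ∑_{i<n} |A i i|^α + a ∑_{i<j<n} |A i j|^α`. -/
noncomputable def blockEnergy (α a b : ℝ) (n : ℕ) (A : ℕ → ℕ → ℂ) : ℝ :=
  ∑ p ∈ upperPairs n, tailWeight a b p * ‖A p.1 p.2‖ ^ α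

lemma blockEnergy_eq {α a b : ℝ} (n : ℕ) (A : ℕ → ℕ → ℂ) :
    blockEnergy α a b n A = b * ∑ i ∈ Finset.range n, ‖A i i‖ ^ α +
      a * ∑ p ∈ (upperPairs n).filter (fun p => p.1 < p.2), ‖A p.1 p.2‖ ^ α := by
  unfold blockEnergy
  rw [← Finset.sum_filter_add_sum_filter_not (upperPairs n) (fun p => p.1 = p.2)]
  congr 1
  · rw [Finset.mul_sum]
    symm
    refine Finset.sum_bij (fun i _ => (i, i)) ?_ ?_ ?_ ?_
    · intro i hi; simpa [mem_upperPairs] using hi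
    · intro i _ j _ h; simpa using h
    · rintro ⟨i, j⟩ h
      simp only [Finset.mem_filter, mem_upperPairs] at h
      exact ⟨i, by simp only [Finset.mem_range]; omega, by simp [h.2]⟩
    · intro i _; simp [tailWeight]
  · rw [Finset.mul_sum]
    refine Finset.sum_congr ?_ ?_
    · ext p
      simp only [Finset.mem_filter, mem_upperPairs]
      omega
    · intro p hp
      rw [tailWeight, if_neg (by simp at hp; omega)]

/-- The positions `(i, j)` and `(j, i)` contribute equally, which turns the weight `a / 2` over `i ≠
j` into `a` over `i < j`, one term per independent variable. -/
lemma energy_eq_blockEnergy {α a b : ℝ} (hα : 0 < α) (ha : 0 ≤ a) (hb : 0 ≤ b) {n : ℕ}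
    (A : Sparse r) (hA : InBlock n A.entry) :
    energy α a b A = ENNReal.ofReal (blockEnergy α a b n A.entry) := by
  have hpow : ∀ z : ℂ, ‖z‖ₑ ^ α = ENNReal.ofReal (‖z‖ ^ α) := fun z => by
    rw [← ofReal_norm, ENNReal.ofReal_rpow_of_nonneg (norm_nonneg _) hα.le]
  have hnn : ∀ z : ℂ, 0 ≤ ‖z‖ ^ α := fun z => by positivity
  have h1 : ∑' i : ℕ, ‖A.entry i i‖ₑ ^ α =
      ENNReal.ofReal (∑ i ∈ Finset.range n, ‖A.entry i i‖ ^ α) := by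
    rw [tsum_eq_sum (s := Finset.range n), ENNReal.ofReal_sum_of_nonneg fun i _ => hnn _]
    · simp only [hpow]
    · intro i hi
      rw [hA i i (Or.inl (by simpa using hi))]
      simp [hα]
  set F := (upperPairs n).filter (fun p : ℕ × ℕ => p.1 < p.2)
  have h2 : ∑' p : {p : ℕ × ℕ // p.1 ≠ p.2}, ‖A.entry p.1.1 p.1.2‖ₑ ^ α =
      ENNReal.ofReal (2 * ∑ p ∈ F, ‖A.entry p.1 p.2‖ ^ α) := by
    have h3 : ∑' p : {p : ℕ × ℕ // p.1 ≠ p.2}, ‖A.entry p.1.1 p.1.2‖ₑ ^ α =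
        ∑' p : ℕ × ℕ, Set.indicator {p : ℕ × ℕ | p.1 ≠ p.2}
          (fun p => ‖A.entry p.1 p.2‖ₑ ^ α) p :=
      tsum_subtype {p : ℕ × ℕ | p.1 ≠ p.2} fun p => ‖A.entry p.1 p.2‖ₑ ^ α
    have hdisj : Disjoint F (F.map (Equiv.prodComm ℕ ℕ).toEmbedding) := by
      rw [Finset.disjoint_left]
      rintro ⟨i, j⟩ h h'
      simp only [F, Finset.mem_map_equiv, Finset.mem_filter] at h h'
      have := h.2
      have := h'.2
      simp at *
      omega
    rw [h3, tsum_eq_sum (s := F ∪ F.map (Equiv.prodComm ℕ ℕ).toEmbedding),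
      Finset.sum_union hdisj, Finset.sum_map, two_mul, ENNReal.ofReal_add
        (Finset.sum_nonneg fun i _ => hnn _) (Finset.sum_nonneg fun i _ => hnn _),
      ENNReal.ofReal_sum_of_nonneg fun i _ => hnn _]
    · congr 1 <;> refine Finset.sum_congr rfl fun p hp => ?_
      · have : p.1 ≠ p.2 := by simp [F] at hp; omega
        rw [Set.indicator_of_mem (by exact this), hpow]
      · have : p.2 ≠ p.1 := by simp [F] at hp; omega
        rw [Set.indicator_of_mem (by exact this), hpow]
        simp [A.norm_entry_swap p.1 p.2]
    · rintro ⟨i, j⟩ hp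
      simp only [F, Finset.mem_union, Finset.mem_map_equiv, Finset.mem_filter, mem_upperPairs,
        Equiv.prodComm_symm, Equiv.prodComm_apply, Prod.swap_prod_mk, not_or] at hp
      by_cases hij : i = j
      · exact Set.indicator_of_notMem (by simpa using hij) _
      · rw [Set.indicator_of_mem (by exact hij)]
        dsimp only
        rw [hA i j (by omega)]
        simp [hα]
  rw [energy, h1, h2, ← ENNReal.ofReal_mul hb, ← ENNReal.ofReal_mul (by linarith),
    ← ENNReal.ofReal_add]
  · refine congrArg ENNReal.ofReal (Eq.trans ?_ (blockEnergy_eq n A.entry).symm)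
    simp only [F]
    ring
  · exact mul_nonneg hb (Finset.sum_nonneg fun i _ => hnn _)
  · exact mul_nonneg (by linarith) (mul_nonneg (by norm_num) (Finset.sum_nonneg fun i _ => hnn _))

/-! ## Matrices supported in a block -/

open Classical in
/-- The class of a matrix, if it is sparse, and the class of `0` otherwise. -/
noncomputable def classOf (r : ℕ) (A : ℕ → ℕ → ℂ) : SparseClass r :=
  if h : IsSparse r A then proj ⟨A, h⟩ else proj ⟨0, isSparse_zero r⟩

lemma classOf_eq {A : ℕ → ℕ → ℂ} (h : IsSparse r A) : classOf r A = proj ⟨A, h⟩ := dif_pos h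

/-- The sparse matrices supported in the first `n` rows and columns. -/
def blockSparse (r n : ℕ) : Set (ℕ → ℕ → ℂ) := {A | IsSparse r A ∧ InBlock n A}

/-- Inside a block, having at most `r` nonzero entries is a finite union, over the possible supports
`T`, of conditions that coordinates vanish. -/
lemma isClosed_blockSparse (r n : ℕ) : IsClosed (blockSparse r n) := by
  classical
  have hent : ∀ i j, Continuous fun A : ℕ → ℕ → ℂ => A i j := fun i j => by fun_prop
  have : blockSparse r n = {A | ∀ i j, star (A j i) = A i j} ∩ {A | InBlock n A} ∩
      ⋃ T ∈ (Finset.range n ×ˢ Finset.range n).powerset.filter (fun T => T.card ≤ r),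
        {A | ∀ p : ℕ × ℕ, p ∉ T → A p.1 p.2 = 0} := by
    ext A
    simp only [blockSparse, IsSparse, Set.mem_ofPred_eq, Set.mem_inter_iff, Set.mem_iUnion,
      Finset.mem_filter, Finset.mem_powerset, exists_prop]
    constructor
    · rintro ⟨⟨h1, h2⟩, h3⟩
      refine ⟨⟨fun i j => Matrix.IsHermitian.apply h1 i j, h3⟩, ?_⟩
      have hfin : {p : ℕ × ℕ | A p.1 p.2 ≠ 0}.Finite := Set.finite_of_encard_le_coe h2
      refine ⟨hfin.toFinset, ⟨?_, ?_⟩, fun p hp => by simpa using hp⟩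
      · intro p hp
        by_contra hn
        simp only [Set.Finite.mem_toFinset, Set.mem_ofPred_eq] at hp
        refine hp (h3 _ _ ?_)
        simp only [Finset.mem_product, Finset.mem_range] at hn
        omega
      · rw [hfin.encard_eq_coe_toFinset_card] at h2
        exact_mod_cast h2
    · rintro ⟨⟨h1, h3⟩, T, ⟨-, hT⟩, h4⟩
      refine ⟨⟨Matrix.IsHermitian.ext h1, ?_⟩, h3⟩
      refine (Set.encard_le_encard (t := (T : Set (ℕ × ℕ))) fun p hp => ?_).trans ?_
      · by_contra hpT
        exact hp (h4 p hpT)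
      · rw [Set.encard_coe_eq_coe_finsetCard]
        exact_mod_cast hT
  rw [this]
  refine (IsClosed.inter ?_ ?_).inter (isClosed_biUnion_finset fun T _ => ?_)
  · simp only [Set.ofPred_forall]
    exact isClosed_iInter fun i => isClosed_iInter fun j =>
      isClosed_eq (continuous_star.comp (hent j i)) (hent i j)
  · simp only [InBlock, Set.ofPred_forall]
    exact isClosed_iInter fun i => isClosed_iInter fun j => isClosed_iInter fun _ =>
      isClosed_eq (hent i j) continuous_const
  · simp only [Set.ofPred_forall]
    exact isClosed_iInter fun p => isClosed_iInter fun _ => isClosed_eq (hent _ _) continuous_const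

/-- The product topology controls only finitely many entries at a time; restricting to a fixed block
makes this control uniform. -/
lemma continuousOn_classOf (r n : ℕ) : ContinuousOn (classOf r) (blockSparse r n) := by
  intro A hA
  rw [ContinuousWithinAt, Metric.tendsto_nhds]
  intro δ hδ
  have h1 : ∀ᶠ B in 𝓝[blockSparse r n] A,
      ∀ p ∈ Finset.range n ×ˢ Finset.range n, ‖B p.1 p.2 - A p.1 p.2‖ < δ / 2 := by
    rw [Filter.eventually_all_finset]
    intro p _
    have hc : Continuous fun B : ℕ → ℕ → ℂ => ‖B p.1 p.2 - A p.1 p.2‖ := by fun_prop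
    exact nhdsWithin_le_nhds (hc.continuousAt.eventually_lt continuousAt_const (by simpa))
  filter_upwards [h1, self_mem_nhdsWithin] with B hB hBs
  rw [classOf_eq hA.1, classOf_eq hBs.1, dist_comm, dist_proj]
  refine (orbitDist_le_supDist _ _).trans_lt (lt_of_le_of_lt (ciSup_le fun p => ?_)
    (half_lt_self hδ))
  by_cases hp : p ∈ Finset.range n ×ˢ Finset.range n
  · exact (hB p hp).le
  · have : n ≤ p.1 ∨ n ≤ p.2 := by
      simp only [Finset.mem_product, Finset.mem_range] at hp
      omega
    simp only [hA.2 _ _ this, hBs.2 _ _ this]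
    simpa using by positivity

/-! ## The rate function -/

section rate

variable {α a b ε : ℝ} {ν₁ ν₂ : Measure (Metric.sphere (0 : ℂ) 1)}

/-- The angle map is discontinuous only at `0`, which the constraint `ε ≤ ‖z‖` keeps away. -/
lemma isClosed_admissibleEntry (hε : 0 < ε) (ν : Measure (Metric.sphere (0 : ℂ) 1)) :
    IsClosed {z : ℂ | AdmissibleEntry ε ν z} := by
  have hK : IsCompact ((↑) '' ν.support : Set ℂ) :=
    (Measure.isClosed_support.isCompact).image continuous_subtype_val
  have h2 : IsClosed {z : ℂ | (ε ≤ ‖z‖ ∧ ‖z‖ ≤ ε⁻¹) ∧ z / (‖z‖ : ℂ) ∈ ((↑) '' ν.support : Set ℂ)} := by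
    have hs : IsClosed {z : ℂ | ε ≤ ‖z‖ ∧ ‖z‖ ≤ ε⁻¹} :=
      (isClosed_le continuous_const continuous_norm).inter
        (isClosed_le continuous_norm continuous_const)
    refine ContinuousOn.preimage_isClosed_of_isClosed (f := fun z : ℂ => z / (‖z‖ : ℂ)) ?_ hs
      hK.isClosed
    refine continuousOn_id.div (Complex.continuous_ofReal.comp continuous_norm).continuousOn ?_
    intro z hz
    have : 0 < ‖z‖ := hε.trans_le hz.1
    exact_mod_cast this.ne'
  exact isClosed_singleton.union h2

/-- The matrices of the domain supported in the first `r` rows and columns with energy at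
most `t`. -/
def domainBlock (α a b ε : ℝ) (ν₁ ν₂ : Measure (Metric.sphere (0 : ℂ) 1)) (r : ℕ) (t : ℝ) :
    Set (ℕ → ℕ → ℂ) :=
  {A | A ∈ blockSparse r r ∧ ((∀ i, AdmissibleEntry ε ν₁ (A i i)) ∧
    ∀ i j, i < j → AdmissibleEntry ε ν₂ (A i j)) ∧ blockEnergy α a b r A ≤ t}

lemma AdmissibleEntry.norm_le {ν : Measure (Metric.sphere (0 : ℂ) 1)} {z : ℂ} (hε : 0 < ε)
    (h : AdmissibleEntry ε ν z) : ‖z‖ ≤ ε⁻¹ := by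
  rcases h with rfl | h
  · simpa using hε.le
  · exact h.1.2

lemma isCompact_domainBlock (hα : 0 < α) (hε : 0 < ε) (r : ℕ) (t : ℝ) :
    IsCompact (domainBlock α a b ε ν₁ ν₂ r t) := by
  have hent : ∀ i j, Continuous fun A : ℕ → ℕ → ℂ => A i j := fun i j => by fun_prop
  have hK : IsCompact {A : ℕ → ℕ → ℂ | ∀ i, A i ∈ {f : ℕ → ℂ | ∀ j, f j ∈ Metric.closedBall 0 ε⁻¹}} :=
    isCompact_pi_infinite fun i => isCompact_pi_infinite fun j => isCompact_closedBall _ _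
  refine hK.of_isClosed_subset ?_ ?_
  · refine (isClosed_blockSparse r r).inter (IsClosed.inter (IsClosed.inter ?_ ?_) ?_)
    · change IsClosed {A : ℕ → ℕ → ℂ | ∀ i, AdmissibleEntry ε ν₁ (A i i)}
      simp only [Set.ofPred_forall]
      exact isClosed_iInter fun i => (isClosed_admissibleEntry hε ν₁).preimage (hent i i)
    · change IsClosed {A : ℕ → ℕ → ℂ | ∀ i j, i < j → AdmissibleEntry ε ν₂ (A i j)}
      simp only [Set.ofPred_forall]
      exact isClosed_iInter fun i => isClosed_iInter fun j => isClosed_iInter fun _ =>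
        (isClosed_admissibleEntry hε ν₂).preimage (hent i j)
    · have : Continuous (blockEnergy α a b r) := continuous_finsetSum _ fun p _ =>
        continuous_const.mul ((hent _ _).norm.rpow_const fun _ => Or.inr hα.le)
      exact isClosed_le this continuous_const
  · rintro A ⟨h1, h2, -⟩ i j
    rw [mem_closedBall_zero_iff]
    rcases lt_trichotomy i j with h | h | h
    · exact (h2.2 i j h).norm_le hε
    · subst h; exact (h2.1 i).norm_le hε
    · rw [← (⟨A, h1.1⟩ : Sparse r).norm_entry_swap i j]
      exact (h2.2 j i h).norm_le hε

lemma rate_proj_of_mem {A : Sparse r} (hA : A ∈ domain ε ν₁ ν₂ r) :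
    rate α a b ε ν₁ ν₂ r (proj A) = energy α a b A :=
  if_pos ⟨A, hA, rfl⟩

lemma rate_eq_top {x : SparseClass r} (hx : x ∉ proj '' domain ε ν₁ ν₂ r) :
    rate α a b ε ν₁ ν₂ r x = ⊤ := if_neg hx

/-- Relabelling into the first `r` rows preserves both admissibility and energy, so compactness of
level sets reduces to compactness of a set of block matrices, carried over by `classOf`. -/
lemma rate_sublevel (hα : 0 < α) (ha : 0 ≤ a) (hb : 0 ≤ b) (t : ℝ≥0) :
    {x | rate α a b ε ν₁ ν₂ r x ≤ t} = classOf r '' domainBlock α a b ε ν₁ ν₂ r t := by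
  ext x
  constructor
  · intro hx
    have hx' : x ∈ proj '' domain ε ν₁ ν₂ r := by
      by_contra h
      simp [rate_eq_top h] at hx
    obtain ⟨A, hA, hAb, rfl⟩ := exists_rep_inBlock hx'
    refine ⟨A.entry, ⟨⟨A.isSparse, hAb⟩, hA, ?_⟩, classOf_eq A.isSparse⟩
    rw [Set.mem_ofPred_eq, rate_proj_of_mem hA, energy_eq_blockEnergy hα ha hb A hAb,
      ENNReal.ofReal_le_iff_le_toReal (by simp)] at hx
    simpa using hx
  · rintro ⟨A, ⟨⟨hs, hAb⟩, hA, ht⟩, rfl⟩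
    have hd : (⟨A, hs⟩ : Sparse r) ∈ domain ε ν₁ ν₂ r := hA
    rw [classOf_eq hs, Set.mem_ofPred_eq, rate_proj_of_mem hd,
      energy_eq_blockEnergy hα ha hb _ hAb, ENNReal.ofReal_le_iff_le_toReal (by simp)]
    simpa using ht

lemma isGood_rate (hα : 0 < α) (ha : 0 ≤ a) (hb : 0 ≤ b) (hε : 0 < ε) :
    IsGood (rate α a b ε ν₁ ν₂ r) := by
  intro t
  rw [rate_sublevel hα ha hb]
  exact (isCompact_domainBlock hα hε r t).image_of_continuousOn
    ((continuousOn_classOf r r).mono fun A hA => hA.1)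

lemma lowerSemicontinuous_rate (hα : 0 < α) (ha : 0 ≤ a) (hb : 0 ≤ b) (hε : 0 < ε) :
    LowerSemicontinuous (rate α a b ε ν₁ ν₂ r) := by
  rw [lowerSemicontinuous_iff_isClosed_preimage]
  intro t
  induction t with
  | top => simp
  | coe t => exact (isGood_rate hα ha hb hε t).isClosed

lemma blockEnergy_le_of_mem_domain (hα : 0 < α) (ha : 0 ≤ a) (hb : 0 ≤ b) (hε : 0 < ε)
    {A : Sparse r} (hA : A ∈ domain ε ν₁ ν₂ r) :
    blockEnergy α a b r A.entry ≤ ∑ p ∈ upperPairs r, tailWeight a b p * ε⁻¹ ^ α := by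
  refine Finset.sum_le_sum fun p hp => ?_
  have hw : 0 ≤ tailWeight a b p := by unfold tailWeight; split_ifs <;> assumption
  refine mul_le_mul_of_nonneg_left (Real.rpow_le_rpow (norm_nonneg _) ?_ hα.le) hw
  rcases (mem_upperPairs.1 hp).1.eq_or_lt with h | h
  · rw [← h]; exact (hA.1 _).norm_le hε
  · exact (hA.2 _ _ h).norm_le hε

/-- The classes that meet the domain form a compact set. -/
lemma isCompact_proj_domain (hα : 0 < α) (ha : 0 ≤ a) (hb : 0 ≤ b) (hε : 0 < ε) :
    IsCompact (proj '' domain ε ν₁ ν₂ r) := by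
  -- Admissible entries are bounded by `ε⁻¹`, so the rate is at most `M` wherever it is finite, and
  -- the set is itself a level set.
  set M : ℝ := ∑ p ∈ upperPairs r, tailWeight a b p * ε⁻¹ ^ α
  have : proj '' domain ε ν₁ ν₂ r = {x | rate α a b ε ν₁ ν₂ r x ≤ M.toNNReal} := by
    ext x
    constructor
    · intro hx
      obtain ⟨A, hA, hAb, rfl⟩ := exists_rep_inBlock hx
      rw [Set.mem_ofPred_eq, rate_proj_of_mem hA, energy_eq_blockEnergy hα ha hb A hAb]
      exact ENNReal.ofReal_le_ofReal (blockEnergy_le_of_mem_domain hα ha hb hε hA)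
    · intro hx
      by_contra h
      simp [rate_eq_top h] at hx
  rw [this]
  exact isGood_rate hα ha hb hε _

end rate

/-! ## Tails -/

/-- The speed of the large deviations principle. -/
noncomputable def speed (α : ℝ) (N : ℕ) : ℝ := (N : ℝ) ^ (α / 2)

lemma tendsto_speed {α : ℝ} (hα : 0 < α) : Tendsto (speed α) atTop atTop :=
  (tendsto_rpow_atTop (by positivity)).comp tendsto_natCast_atTop_atTop

lemma eventually_exp_speed_le {α κ C : ℝ} (hα : 0 < α) (hκ : 0 < κ) (hC : 0 < C) :
    ∀ᶠ N : ℕ in atTop, Real.exp (-κ * speed α N) ≤ C := by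
  have h : Tendsto (fun N => Real.exp (-κ * speed α N)) atTop (𝓝 0) :=
    Real.tendsto_exp_atBot.comp ((tendsto_speed hα).const_mul_atTop_of_neg (by linarith))
  exact h.eventually_le_const hC

lemma eventually_pow_mul_exp_speed_le {α κ C : ℝ} (k : ℕ) (hα : 0 < α) (hκ : 0 < κ)
    (hC : 0 < C) : ∀ᶠ N : ℕ in atTop, (N : ℝ) ^ k * Real.exp (-κ * speed α N) ≤ C := by
  -- With `x = N ^ (α / 2)` one has `N ^ k = x ^ (2 * k / α)`.
  have h1 : Tendsto (fun x : ℝ => x ^ (2 * k / α) * Real.exp (-κ * x)) atTop (𝓝 0) :=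
    tendsto_rpow_mul_exp_neg_mul_atTop_nhds_zero _ _ hκ
  have h2 := h1.comp (tendsto_speed hα)
  filter_upwards [h2.eventually_le_const hC] with N hN
  refine le_trans (le_of_eq ?_) hN
  simp only [Function.comp_apply, speed]
  rw [← Real.rpow_mul (by positivity), ← Real.rpow_natCast]
  congr 2
  field_simp

lemma mul_sqrt_rpow {α s : ℝ} (hs : 0 ≤ s) (N : ℕ) :
    (s * √(N : ℝ)) ^ α = s ^ α * speed α N := by
  rw [Real.mul_rpow hs (Real.sqrt_nonneg _), Real.sqrt_eq_rpow, ← Real.rpow_mul (by positivity),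
    speed]
  congr 2
  ring

lemma tendsto_mul_sqrt {s : ℝ} (hs : 0 < s) :
    Tendsto (fun N : ℕ => s * √(N : ℝ)) atTop atTop :=
  (Real.tendsto_sqrt_atTop.comp tendsto_natCast_atTop_atTop).const_mul_atTop hs

section tails

variable {Ω : Type*} [MeasurableSpace Ω] {P : Measure Ω} [IsProbabilityMeasure P] {Y : Ω → ℂ}
  {α c : ℝ}

lemma HasTail.eventually_lt_le (h : HasTail P Y α c) {c' : ℝ} (hc' : c' < c) :
    ∀ᶠ t : ℝ in atTop, P.real {ω | t < ‖Y ω‖} ≤ Real.exp (-c' * t ^ α) := by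
  filter_upwards [h.eventually_const_lt hc', eventually_gt_atTop 0] with t ht ht0
  rcases (measureReal_nonneg (μ := P) (s := {ω | t < ‖Y ω‖})).eq_or_lt' with h0 | h0
  · rw [h0]; exact (Real.exp_pos _).le
  · rw [← Real.log_le_iff_le_exp h0]
    have hp : 0 < t ^ α := Real.rpow_pos_of_pos ht0 _
    rw [Real.rpow_neg ht0.le] at ht
    have := mul_lt_mul_of_pos_left ht hp
    have e : t ^ α * (-(t ^ α)⁻¹ * Real.log (P.real {ω | t < ‖Y ω‖})) =
        -Real.log (P.real {ω | t < ‖Y ω‖}) := by field_simp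
    rw [e] at this
    linarith

/-- The tail assumption concerns strict inequalities. The event `t ≤ ‖Y‖` lies in `θ * t < ‖Y‖` for
`θ < 1`, and `θ` close to `1` costs arbitrarily little in the exponent. -/
lemma HasTail.eventually_le (hα : 0 < α) (h : HasTail P Y α c) {c' : ℝ} (hc : 0 < c)
    (hc' : c' < c) :
    ∀ᶠ t : ℝ in atTop, P.real {ω | t ≤ ‖Y ω‖} ≤ Real.exp (-c' * t ^ α) := by
  obtain ⟨c₁, h1, h2⟩ := exists_between (max_lt hc' hc)
  have hc1 : 0 < c₁ := (le_max_right _ _).trans_lt h1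
  have hcont : ContinuousAt (fun θ : ℝ => c₁ * θ ^ α) 1 :=
    continuousAt_const.mul (Real.continuousAt_rpow_const _ _ (Or.inr hα.le))
  have hev : ∀ᶠ θ : ℝ in 𝓝[<] 1, c' < c₁ * θ ^ α :=
    nhdsWithin_le_nhds (hcont.eventually_const_lt (by simpa using (le_max_left _ _).trans_lt h1))
  obtain ⟨θ, ⟨hθ, hθ1⟩, hθ0⟩ := ((hev.and self_mem_nhdsWithin).and
    (nhdsWithin_le_nhds (lt_mem_nhds (zero_lt_one (α := ℝ))))).exists
  have hθ0 : 0 < θ := hθ0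
  filter_upwards [(tendsto_id.const_mul_atTop hθ0).eventually (h.eventually_lt_le h2),
    eventually_gt_atTop 0] with t ht ht0
  refine le_trans (measureReal_mono fun ω hω => ?_) (ht.trans ?_)
  · exact lt_of_lt_of_le (by simpa using mul_lt_mul_of_pos_right hθ1 ht0) hω
  · rw [id, Real.exp_le_exp, Real.mul_rpow hθ0.le ht0.le]
    have := mul_le_mul_of_nonneg_right hθ.le (Real.rpow_nonneg ht0.le α)
    linarith

lemma HasTail.eventually_ge (h : HasTail P Y α c) {c' : ℝ} (hc : 0 < c) (hc' : c < c') :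
    ∀ᶠ t : ℝ in atTop, Real.exp (-c' * t ^ α) ≤ P.real {ω | t ≤ ‖Y ω‖} := by
  filter_upwards [h.eventually_lt_const hc', h.eventually_const_lt hc, eventually_gt_atTop 0]
    with t ht ht' ht0
  -- Since `Real.log 0 = 0`, a null tail would make the expression in `HasTail` vanish, contrary to
  -- its being positive here.
  have h0 : 0 < P.real {ω | t < ‖Y ω‖} := by
    refine measureReal_nonneg.lt_of_ne' fun h0 => ?_
    rw [h0] at ht'
    simp at ht'
  refine le_trans ?_ (measureReal_mono (μ := P) (s₁ := {ω | t < ‖Y ω‖}) fun ω (hω : t < ‖Y ω‖) => hω.le)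
  rw [← Real.le_log_iff_exp_le h0]
  have hp : 0 < t ^ α := Real.rpow_pos_of_pos ht0 _
  rw [Real.rpow_neg ht0.le] at ht
  have := mul_lt_mul_of_pos_left ht hp
  have e : t ^ α * (-(t ^ α)⁻¹ * Real.log (P.real {ω | t < ‖Y ω‖})) =
      -Real.log (P.real {ω | t < ‖Y ω‖}) := by field_simp
  rw [e] at this
  linarith

lemma HasTail.eventually_speed_le (hα : 0 < α) (h : HasTail P Y α c) (hc : 0 < c) {s κ : ℝ}
    (hs : 0 < s) (hκ : κ < c * s ^ α) :
    ∀ᶠ N : ℕ in atTop, P.real {ω | s * √(N : ℝ) ≤ ‖Y ω‖} ≤ Real.exp (-κ * speed α N) := by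
  have hsα : 0 < s ^ α := Real.rpow_pos_of_pos hs _
  filter_upwards [(tendsto_mul_sqrt hs).eventually
    (h.eventually_le hα hc (c' := κ / s ^ α) (by rwa [div_lt_iff₀ hsα]))] with N hN
  refine hN.trans (le_of_eq ?_)
  rw [mul_sqrt_rpow hs.le]
  congr 1
  field_simp

lemma HasTail.eventually_speed_ge (h : HasTail P Y α c) (hc : 0 < c) {s κ : ℝ}
    (hs : 0 < s) (hκ : c * s ^ α < κ) :
    ∀ᶠ N : ℕ in atTop, Real.exp (-κ * speed α N) ≤ P.real {ω | s * √(N : ℝ) ≤ ‖Y ω‖} := by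
  have hsα : 0 < s ^ α := Real.rpow_pos_of_pos hs _
  filter_upwards [(tendsto_mul_sqrt hs).eventually
    (h.eventually_ge hc (c' := κ / s ^ α) (by rwa [lt_div_iff₀ hsα]))] with N hN
  refine le_trans (le_of_eq ?_) hN
  rw [mul_sqrt_rpow hs.le]
  congr 1
  field_simp

/-! ## Angles -/

/-- The points of the circle on the coordinate axes. -/
def axisPoints : Set (Metric.sphere (0 : ℂ) 1) := {w | (w : ℂ).re = 0 ∨ (w : ℂ).im = 0}

lemma measurableSet_axisPoints : MeasurableSet axisPoints := by
  have h1 : Continuous fun w : Metric.sphere (0 : ℂ) 1 => (w : ℂ).re :=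
    Complex.continuous_re.comp continuous_subtype_val
  have h2 : Continuous fun w : Metric.sphere (0 : ℂ) 1 => (w : ℂ).im :=
    Complex.continuous_im.comp continuous_subtype_val
  exact ((isClosed_eq h1 continuous_const).union (isClosed_eq h2 continuous_const)).measurableSet

lemma div_norm_mem_sphere {z : ℂ} (hz : z ≠ 0) : z / (‖z‖ : ℂ) ∈ Metric.sphere (0 : ℂ) 1 := by
  simp [hz]

lemma norm_mul_div_norm (z : ℂ) : (‖z‖ : ℂ) * (z / (‖z‖ : ℂ)) = z := by
  rcases eq_or_ne z 0 with rfl | hz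
  · simp
  · have : (‖z‖ : ℂ) ≠ 0 := by simpa using hz
    field_simp

lemma cInf_le_norm (z : ℂ) : cInf z ≤ ‖z‖ :=
  max_le (Complex.abs_re_le_norm z) (Complex.abs_im_le_norm z)

lemma cInf_eq_norm_of_mem_axisPoints {z : ℂ}
    (h : z / (‖z‖ : ℂ) ∈ ((↑) '' axisPoints : Set ℂ)) : cInf z = ‖z‖ := by
  obtain ⟨w, hw, hwz⟩ := h
  have hz := norm_mul_div_norm z
  rw [← hwz] at hz
  have h1 : z.re = ‖z‖ * (w : ℂ).re := by conv_lhs => rw [← hz, Complex.re_ofReal_mul]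
  have h2 : z.im = ‖z‖ * (w : ℂ).im := by conv_lhs => rw [← hz, Complex.im_ofReal_mul]
  refine le_antisymm (cInf_le_norm z) ?_
  rcases hw with hw | hw
  · rw [hw, mul_zero] at h1
    rw [← Complex.abs_im_eq_norm.2 h1]
    exact le_max_right _ _
  · rw [hw, mul_zero] at h2
    rw [← Complex.abs_re_eq_norm.2 h2]
    exact le_max_left _ _

/-- Almost surely, a large value has its angle in any given set of full measure. -/
lemma AngleDecoupled.ae_mem {ν : Measure (Metric.sphere (0 : ℂ) 1)} (h : AngleDecoupled P Y ν)
    {U : Set (Metric.sphere (0 : ℂ) 1)} (hU : MeasurableSet U) (hν : ν Uᶜ = 0) :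
    ∃ t₀ : ℝ, ∀ᵐ ω ∂P, t₀ ≤ ‖Y ω‖ → Y ω / (‖Y ω‖ : ℂ) ∈ ((↑) '' U : Set ℂ) := by
  obtain ⟨t₀, ht₀, h⟩ := h
  refine ⟨t₀, ?_⟩
  have h0 := h t₀ le_rfl Uᶜ hU.compl
  rw [hν, zero_mul] at h0
  rw [ae_iff]
  refine measure_mono_null (fun ω hω => ?_) h0
  simp only [Set.mem_ofPred_eq, Classical.not_imp] at hω ⊢
  have hY : Y ω ≠ 0 := norm_pos_iff.1 (ht₀.trans_le hω.1)
  refine ⟨⟨⟨_, div_norm_mem_sphere hY⟩, fun hmem => hω.2 ⟨_, hmem, rfl⟩, rfl⟩, hω.1⟩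

/-- The angle of a real variable is on an axis. -/
lemma AngleDecoupled.axisPoints_of_real {ν : Measure (Metric.sphere (0 : ℂ) 1)}
    [IsProbabilityMeasure ν] (hY : ∀ ω, (Y ω).im = 0) (h : AngleDecoupled P Y ν) (hc : 0 < c)
    (ht : HasTail P Y α c) : ν axisPointsᶜ = 0 := by
  obtain ⟨t₀, ht₀, h⟩ := h
  -- At this `t` the tail has positive probability, so the decoupling identity forces `ν axisPointsᶜ
  -- = 0`.
  obtain ⟨t, ht1, ht2⟩ := ((ht.eventually_ge hc (lt_add_one c)).and (eventually_ge_atTop t₀)).exists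
  have h0 := h t ht2 axisPointsᶜ measurableSet_axisPoints.compl
  have hempty : {ω | Y ω / (‖Y ω‖ : ℂ) ∈ ((↑) '' axisPointsᶜ : Set ℂ) ∧ t ≤ ‖Y ω‖} = ∅ := by
    ext ω
    simp only [Set.mem_ofPred_eq, Set.mem_empty_iff_false, iff_false, not_and]
    rintro ⟨w, hw, hwY⟩
    refine absurd (Or.inr ?_) hw
    rw [hwY, Complex.div_ofReal_im, hY, zero_div]
  rw [hempty, measure_empty, eq_comm, mul_eq_zero] at h0
  refine h0.resolve_right fun h1 => ?_
  rw [measureReal_def, h1] at ht1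
  exact absurd ht1 (not_le.2 (by simpa using Real.exp_pos _))

/-- Both numbers are below `1`, so lowering the exponent from `2` to `α` strictly increases each
power. This is the extra cost of an oblique direction. -/
lemma one_lt_rpow_add_rpow (hα : α < 2) {x y : ℝ} (hx : 0 < x) (hy : 0 < y)
    (h : x ^ 2 + y ^ 2 = 1) : 1 < x ^ α + y ^ α := by
  have hx1 : x < 1 := by nlinarith
  have hy1 : y < 1 := by nlinarith
  have h1 := Real.rpow_lt_rpow_of_exponent_gt hx hx1 hα
  have h2 := Real.rpow_lt_rpow_of_exponent_gt hy hy1 hα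
  rw [Real.rpow_two] at h1 h2
  linarith

/-- If the real and imaginary parts are independent, then the limiting angle is on an axis. -/
lemma AngleDecoupled.axisPoints_of_indep {ν : Measure (Metric.sphere (0 : ℂ) 1)}
    [IsProbabilityMeasure ν] (hα : 0 < α) (hα2 : α < 2) (hc : 0 < c)
    (hind : IndepFun (fun ω => (Y ω).re) (fun ω => (Y ω).im) P)
    (h : AngleDecoupled P Y ν) (ht : HasTail P Y α c) : ν axisPointsᶜ = 0 := by
  have hsub : axisPointsᶜ ⊆ ν.supportᶜ := by
    intro u hu hsupp
    simp only [axisPoints, Set.mem_compl_iff, Set.mem_ofPred_eq, not_or] at hu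
    set x := |(u : ℂ).re| with hx
    set y := |(u : ℂ).im| with hy
    have hx0 : 0 < x := abs_pos.2 hu.1
    have hy0 : 0 < y := abs_pos.2 hu.2
    have hxy : x ^ 2 + y ^ 2 = 1 := by
      have h1 : ‖(u : ℂ)‖ ^ 2 = 1 := by rw [mem_sphere_zero_iff_norm.1 u.2]; norm_num
      rw [Complex.sq_norm, Complex.normSq_apply] at h1
      rw [hx, hy, sq_abs, sq_abs]
      linarith
    have hK := one_lt_rpow_add_rpow hα2 hx0 hy0 hxy
    -- The factor `θ < 1` makes `V` below an open neighbourhood of `u`, while the exponent stays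
    -- strictly above `1`.
    obtain ⟨θ, ⟨hθ, hθ1⟩, hθ0⟩ : ∃ θ : ℝ, (1 < θ ^ α * (x ^ α + y ^ α) ∧ θ < 1) ∧ 0 < θ := by
      have hcont : ContinuousAt (fun θ : ℝ => θ ^ α * (x ^ α + y ^ α)) 1 :=
        (Real.continuousAt_rpow_const _ _ (Or.inr hα.le)).mul continuousAt_const
      have hev : ∀ᶠ θ : ℝ in 𝓝[<] 1, 1 < θ ^ α * (x ^ α + y ^ α) :=
        nhdsWithin_le_nhds (hcont.eventually_const_lt (by simpa using hK))
      exact ((hev.and self_mem_nhdsWithin).and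
        (nhdsWithin_le_nhds (lt_mem_nhds (zero_lt_one (α := ℝ))))).exists
    set K := θ ^ α * (x ^ α + y ^ α)
    -- The constants satisfy `c₁ < c < c₂ < c₁ * K`: `c₁` for the upper tail bounds on the
    -- coordinates, `c₂` for the lower bound on the modulus. The resulting inequality `ν V * exp(-c₂
    -- t ^ α) ≤ exp(-c₁ K t ^ α)` fails for large `t` because `ν V > 0`.
    obtain ⟨c₁, hc1K, hc1⟩ := exists_between ((div_lt_iff₀ (by linarith)).2
      (by nlinarith : c < c * K))
    rw [div_lt_iff₀ (by linarith)] at hc1K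
    obtain ⟨c₂, hc2, hc2K⟩ := exists_between hc1K
    let V : Set (Metric.sphere (0 : ℂ) 1) := {w | θ * x < |(w : ℂ).re| ∧ θ * y < |(w : ℂ).im|}
    have hVo : IsOpen V :=
      (isOpen_lt continuous_const
        (Complex.continuous_re.comp continuous_subtype_val).abs).inter
      (isOpen_lt continuous_const (Complex.continuous_im.comp continuous_subtype_val).abs)
    have hVpos : 0 < ν V := by
      refine (Measure.mem_support_iff_forall u).1 hsupp V (hVo.mem_nhds ⟨?_, ?_⟩)
      · exact mul_lt_of_lt_one_left hx0 hθ1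
      · exact mul_lt_of_lt_one_left hy0 hθ1
    have hVr : 0 < ν.real V := ENNReal.toReal_pos hVpos.ne' (measure_ne_top _ _)
    obtain ⟨t₀, ht₀, h⟩ := h
    have hsmall : ∀ᶠ t : ℝ in atTop, Real.exp (-(c₁ * K - c₂) * t ^ α) < ν.real V :=
      (Real.tendsto_exp_atBot.comp ((tendsto_rpow_atTop hα).const_mul_atTop_of_neg
        (by linarith))).eventually_lt_const hVr
    obtain ⟨t, ht1, ht2, ht3, ht4, ht5, htpos⟩ := (hsmall.and <| (ht.eventually_ge hc hc2).and <|
      ((tendsto_id.const_mul_atTop (mul_pos hθ0 hx0)).eventually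
        (ht.eventually_le hα hc hc1)).and <|
      ((tendsto_id.const_mul_atTop (mul_pos hθ0 hy0)).eventually
        (ht.eventually_le hα hc hc1)).and <|
      (eventually_ge_atTop t₀).and (eventually_gt_atTop 0)).exists
    simp only [id] at ht3 ht4
    have hdec : P.real {ω | Y ω / (‖Y ω‖ : ℂ) ∈ ((↑) '' V : Set ℂ) ∧ t ≤ ‖Y ω‖} =
        ν.real V * P.real {ω | t ≤ ‖Y ω‖} := by
      simp only [measureReal_def]
      rw [h t ht5 V hVo.measurableSet, ENNReal.toReal_mul]
    have hprod : P.real ({ω | θ * x * t ≤ |(Y ω).re|} ∩ {ω | θ * y * t ≤ |(Y ω).im|}) =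
        P.real {ω | θ * x * t ≤ |(Y ω).re|} * P.real {ω | θ * y * t ≤ |(Y ω).im|} := by
      have := hind.measure_inter_preimage_eq_mul {s | θ * x * t ≤ |s|} {s | θ * y * t ≤ |s|}
        (isClosed_le continuous_const continuous_abs).measurableSet
        (isClosed_le continuous_const continuous_abs).measurableSet
      simp only [measureReal_def, ← ENNReal.toReal_mul]
      exact congrArg ENNReal.toReal this
    have hle : P.real {ω | Y ω / (‖Y ω‖ : ℂ) ∈ ((↑) '' V : Set ℂ) ∧ t ≤ ‖Y ω‖} ≤
        P.real ({ω | θ * x * t ≤ |(Y ω).re|} ∩ {ω | θ * y * t ≤ |(Y ω).im|}) := by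
      refine measureReal_mono ?_
      rintro ω ⟨⟨w, hw, hwY⟩, htY⟩
      have hz := norm_mul_div_norm (Y ω)
      rw [← hwY] at hz
      constructor
      · change θ * x * t ≤ |(Y ω).re|
        rw [← hz, Complex.re_ofReal_mul, abs_mul, abs_norm, mul_comm]
        exact mul_le_mul htY hw.1.le (by positivity) (norm_nonneg _)
      · change θ * y * t ≤ |(Y ω).im|
        rw [← hz, Complex.im_ofReal_mul, abs_mul, abs_norm, mul_comm]
        exact mul_le_mul htY hw.2.le (by positivity) (norm_nonneg _)
    have hre : P.real {ω | θ * x * t ≤ |(Y ω).re|} ≤ Real.exp (-c₁ * (θ * x * t) ^ α) :=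
      (measureReal_mono fun ω hω => le_trans hω (Complex.abs_re_le_norm _)).trans ht3
    have him : P.real {ω | θ * y * t ≤ |(Y ω).im|} ≤ Real.exp (-c₁ * (θ * y * t) ^ α) :=
      (measureReal_mono fun ω hω => le_trans hω (Complex.abs_im_le_norm _)).trans ht4
    have hfin : ν.real V * Real.exp (-c₂ * t ^ α) ≤ Real.exp (-(c₁ * K) * t ^ α) := by
      calc ν.real V * Real.exp (-c₂ * t ^ α) ≤ ν.real V * P.real {ω | t ≤ ‖Y ω‖} := by gcongr
        _ ≤ Real.exp (-c₁ * (θ * x * t) ^ α) * Real.exp (-c₁ * (θ * y * t) ^ α) := by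
          rw [← hdec]
          exact hle.trans (hprod.le.trans (mul_le_mul hre him measureReal_nonneg (Real.exp_pos _).le))
        _ = Real.exp (-(c₁ * K) * t ^ α) := by
          rw [← Real.exp_add, Real.mul_rpow (by positivity) htpos.le,
            Real.mul_rpow (by positivity) htpos.le, Real.mul_rpow hθ0.le hx0.le,
            Real.mul_rpow hθ0.le hy0.le]
          congr 1
          simp only [K]
          ring
    refine absurd ht1 (not_lt.2 ?_)
    rw [← le_div_iff₀ (Real.exp_pos _), ← Real.exp_sub] at hfin
    refine hfin.trans (le_of_eq ?_)
    congr 1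
    ring
  exact measure_mono_null hsub Measure.measure_compl_support

/-! ## The cut-off of a single entry -/

open Classical in
/-- The cut-off and rescaling of one entry. -/
noncomputable def cut (ε : ℝ) (N : ℕ) (z : ℂ) : ℂ :=
  if ε * √(N : ℝ) ≤ cInf z ∧ cInf z ≤ ε⁻¹ * √(N : ℝ) then z / (√(N : ℝ) : ℂ) else 0

lemma continuous_cInf : Continuous cInf :=
  Complex.continuous_re.abs.max Complex.continuous_im.abs

lemma measurable_cut (ε : ℝ) (N : ℕ) : Measurable (cut ε N) := by
  classical
  refine Measurable.ite ?_ (measurable_id.div_const _) measurable_const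
  exact ((isClosed_le continuous_const continuous_cInf).inter
    (isClosed_le continuous_cInf continuous_const)).measurableSet

lemma cInf_star (z : ℂ) : cInf (star z) = cInf z := by simp [cInf]

lemma cut_star (ε : ℝ) (N : ℕ) (z : ℂ) : cut ε N (star z) = star (cut ε N z) := by
  unfold cut
  rw [cInf_star]
  split_ifs <;> simp

lemma norm_eq_of_cut_ne_zero {ε : ℝ} {N : ℕ} {z : ℂ} (h : cut ε N z ≠ 0) :
    ‖z‖ = ‖cut ε N z‖ * √(N : ℝ) := by
  unfold cut at h ⊢
  split_ifs at h ⊢ with h1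
  · rw [norm_div, Complex.norm_real, Real.norm_of_nonneg (Real.sqrt_nonneg _), div_mul_cancel₀]
    intro h0
    simp [h0] at h
  · exact absurd rfl h

lemma le_norm_of_cut_ne_zero {ε : ℝ} {N : ℕ} {z : ℂ} (h : cut ε N z ≠ 0) :
    ε * √(N : ℝ) ≤ ‖z‖ := by
  unfold cut at h
  split_ifs at h with h1
  · exact h1.1.trans (cInf_le_norm z)
  · exact absurd rfl h

/-- Almost surely, for large `N`, the cut-off of an entry is admissible. -/
lemma AngleDecoupled.ae_admissible {ν : Measure (Metric.sphere (0 : ℂ) 1)}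
    (h : AngleDecoupled P Y ν) (hν : ν axisPointsᶜ = 0) {ε : ℝ} (hε : 0 < ε) :
    ∀ᶠ N : ℕ in atTop, ∀ᵐ ω ∂P, AdmissibleEntry ε ν (cut ε N (Y ω)) := by
  have hU : ν (ν.support ∩ axisPoints)ᶜ = 0 := by
    rw [Set.compl_inter]
    exact measure_union_null Measure.measure_compl_support hν
  obtain ⟨t₀, ht₀⟩ := h.ae_mem (Measure.isClosed_support.measurableSet.inter
    measurableSet_axisPoints) hU
  filter_upwards [(tendsto_mul_sqrt hε).eventually_ge_atTop t₀, eventually_gt_atTop 0] with N hN hN0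
  filter_upwards [ht₀] with ω hω
  by_cases hc : cut ε N (Y ω) = 0
  · exact Or.inl hc
  right
  have hs : 0 < √(N : ℝ) := Real.sqrt_pos.2 (by exact_mod_cast hN0)
  have hang := hω (hN.trans (le_norm_of_cut_ne_zero hc))
  -- On the axes the truncation window for `cInf` is exactly the modulus window required for
  -- admissibility.
  have hcInf : cInf (Y ω) = ‖Y ω‖ :=
    cInf_eq_norm_of_mem_axisPoints (Set.image_mono Set.inter_subset_right hang)
  have hnorm := norm_eq_of_cut_ne_zero hc
  have hcond : ε * √(N : ℝ) ≤ cInf (Y ω) ∧ cInf (Y ω) ≤ ε⁻¹ * √(N : ℝ) := by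
    by_contra hn
    exact hc (if_neg hn)
  have hcut : cut ε N (Y ω) = Y ω / (√(N : ℝ) : ℂ) := if_pos hcond
  rw [hcInf, hnorm] at hcond
  refine ⟨⟨le_of_mul_le_mul_right hcond.1 hs, le_of_mul_le_mul_right hcond.2 hs⟩, ?_⟩
  have : cut ε N (Y ω) / (‖cut ε N (Y ω)‖ : ℂ) = Y ω / (‖Y ω‖ : ℂ) := by
    have hsC : (√(N : ℝ) : ℂ) ≠ 0 := by exact_mod_cast hs.ne'
    have hn0 : (‖cut ε N (Y ω)‖ : ℂ) ≠ 0 := by simpa using hc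
    rw [hnorm]
    push_cast
    field_simp
    rw [hcut, div_mul_cancel₀ _ hsC]
  rw [this]
  exact Set.image_mono Set.inter_subset_left hang

/-- The window `[ε, ε⁻¹]` must not reduce to a point, which is where `ε ≠ 1` enters. The interval
extends to the right of `ρ`, or to its left if `ρ = ε⁻¹`; having `s ≤ ρ` keeps the cost of reaching
`s` at most that of reaching `ρ`. -/
lemma exists_short_interval {ε ρ δ : ℝ} (hε : 0 < ε) (hε1 : ε ≠ 1) (hδ : 0 < δ) (h1 : ε ≤ ρ)
    (h2 : ρ ≤ ε⁻¹) : ∃ s s' : ℝ, ε ≤ s ∧ s ≤ ρ ∧ s < s' ∧ s' ≤ ε⁻¹ ∧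
      ∀ x ∈ Set.Icc s s', |x - ρ| < δ := by
  have hlt : ε < ε⁻¹ := (h1.trans h2).lt_of_ne fun h => hε1 (by
    have : ε * ε = 1 := by nth_rewrite 2 [h]; exact mul_inv_cancel₀ hε.ne'
    nlinarith)
  rcases h2.eq_or_lt with h | h
  · refine ⟨max ε (ρ - δ / 2), ρ, le_max_left _ _, max_le h1 (by linarith), ?_, h2, ?_⟩
    · exact max_lt (h ▸ hlt) (by linarith)
    · rintro x ⟨hx1, hx2⟩
      have := (le_max_right _ _).trans hx1
      rw [abs_lt]; constructor <;> linarith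
  · refine ⟨ρ, min ε⁻¹ (ρ + δ / 2), h1, le_rfl, lt_min h (by linarith), min_le_left _ _, ?_⟩
    rintro x ⟨hx1, hx2⟩
    have := hx2.trans (min_le_right _ _)
    rw [abs_lt]; constructor <;> linarith

/-- Lower bound for the probability that the cut-off of an entry is close to an admissible
value. -/
lemma AngleDecoupled.eventually_cut_near {ν : Measure (Metric.sphere (0 : ℂ) 1)}
    [IsProbabilityMeasure ν] (hα : 0 < α) (hc : 0 < c)
    (h : AngleDecoupled P Y ν) (hν : ν axisPointsᶜ = 0) (ht : HasTail P Y α c) {ε : ℝ}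
    (hε : 0 < ε) (hε1 : ε ≠ 1) {z : ℂ} (hz : AdmissibleEntry ε ν z) (hz0 : z ≠ 0) {δ κ : ℝ}
    (hδ : 0 < δ) (hκ : c * ‖z‖ ^ α < κ) :
    ∀ᶠ N : ℕ in atTop,
      Real.exp (-κ * speed α N) ≤ P.real {ω | ‖cut ε N (Y ω) - z‖ < δ} := by
  obtain ⟨⟨hz1, hz2⟩, u, hu, huz⟩ := hz.resolve_left hz0
  obtain ⟨s, s', hs1, hs2, hs3, hs4, hs5⟩ :=
    exists_short_interval hε hε1 (half_pos hδ) hz1 hz2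
  have hs0 : 0 < s := hε.trans_le hs1
  have hs0' : 0 < s' := hs0.trans hs3
  let B : Set (Metric.sphere (0 : ℂ) 1) := Metric.ball u (ε * (δ / 2))
  -- Intersecting with the axes loses no mass and ensures that the `cInf` cut-off keeps the entry.
  let V := B ∩ axisPoints
  have hVm : MeasurableSet V := Metric.isOpen_ball.measurableSet.inter measurableSet_axisPoints
  have hVpos : 0 < ν V := by
    have hBpos : 0 < ν B := (Measure.mem_support_iff_forall u).1 hu B
      (Metric.ball_mem_nhds u (by positivity))
    have : ν B ≤ ν V + ν axisPointsᶜ := by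
      refine (measure_mono fun w hw => ?_).trans (measure_union_le _ _)
      by_cases hw' : w ∈ axisPoints
      · exact Or.inl ⟨hw, hw'⟩
      · exact Or.inr hw'
    rw [hν, add_zero] at this
    exact hBpos.trans_le this
  have hVr : 0 < ν.real V := ENNReal.toReal_pos hVpos.ne' (measure_ne_top _ _)
  obtain ⟨t₀, ht₀, h⟩ := h
  have hss : s ^ α < s' ^ α := Real.rpow_lt_rpow hs0.le hs3 hα
  have hsz : s ^ α ≤ ‖z‖ ^ α := Real.rpow_le_rpow hs0.le hs2 hα.le
  -- The event that `‖Y‖ / √N` lies in `[s, s')` is a difference of two tails. With `c * s ^ α < κ₁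
  -- < κ₂ < c * s' ^ α` the subtracted tail is eventually at most half the lower bound for the
  -- first, and `κ₁ < κ` leaves room for the constant `ν V / 2`.
  obtain ⟨κ₁, hκ1, hκ1'⟩ := exists_between
    (lt_min (lt_of_le_of_lt (mul_le_mul_of_nonneg_left hsz hc.le) hκ) ((mul_lt_mul_iff_right₀ hc).2 hss))
  obtain ⟨κ₂, hκ2, hκ2'⟩ := exists_between (hκ1'.trans_le (min_le_right _ _))
  have hκκ : κ₁ < κ := hκ1'.trans_le (min_le_left _ _)
  filter_upwards [ht.eventually_speed_ge hc hs0 hκ1, ht.eventually_speed_le hα hc hs0' hκ2',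
    eventually_exp_speed_le hα (sub_pos.2 hκ2) (half_pos one_pos),
    eventually_exp_speed_le hα (sub_pos.2 hκκ) (half_pos hVr),
    (tendsto_mul_sqrt hs0).eventually_ge_atTop t₀, eventually_gt_atTop 0]
    with N h1 h2 h3 h4 h5 hN0
  have hN : 0 < √(N : ℝ) := Real.sqrt_pos.2 (by exact_mod_cast hN0)
  have hNC : (√(N : ℝ) : ℂ) ≠ 0 := by exact_mod_cast hN.ne'
  have h6 : t₀ ≤ s' * √(N : ℝ) := h5.trans (by gcongr)
  let E : ℝ → Set Ω := fun t => {ω | Y ω / (‖Y ω‖ : ℂ) ∈ ((↑) '' V : Set ℂ) ∧ t ≤ ‖Y ω‖}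
  have hE : ∀ t, t₀ ≤ t → P.real (E t) = ν.real V * P.real {ω | t ≤ ‖Y ω‖} := fun t ht => by
    simp only [E, measureReal_def]
    rw [h t ht V hVm, ENNReal.toReal_mul]
  have hsub : E (s * √(N : ℝ)) ⊆
      {ω | ‖cut ε N (Y ω) - z‖ < δ} ∪ E (s' * √(N : ℝ)) := by
    rintro ω ⟨hang, hω⟩
    by_cases hω' : s' * √(N : ℝ) ≤ ‖Y ω‖
    · exact Or.inr ⟨hang, hω'⟩
    left
    push Not at hω'
    have hcInf : cInf (Y ω) = ‖Y ω‖ :=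
      cInf_eq_norm_of_mem_axisPoints (Set.image_mono Set.inter_subset_right hang)
    have hcut : cut ε N (Y ω) = Y ω / (√(N : ℝ) : ℂ) := by
      refine if_pos ⟨?_, ?_⟩ <;> rw [hcInf]
      · exact le_trans (by gcongr) hω
      · exact hω'.le.trans (by gcongr)
    obtain ⟨w, hw, hwY⟩ := hang
    set x := ‖Y ω‖ / √(N : ℝ) with hx
    have hx1 : s ≤ x := by rwa [hx, le_div_iff₀ hN]
    have hx2 : x ≤ s' := by rw [hx, div_le_iff₀ hN]; exact hω'.le
    have hx0 : 0 < x := hs0.trans_le hx1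
    have e1 : cut ε N (Y ω) = (x : ℂ) * (w : ℂ) := by
      rw [hcut, hwY, hx]
      conv_lhs => rw [← norm_mul_div_norm (Y ω)]
      push_cast
      ring
    have e2 : z = (‖z‖ : ℂ) * (u : ℂ) := by rw [huz, norm_mul_div_norm]
    have hwu : ‖(w : ℂ) - (u : ℂ)‖ < ε * (δ / 2) := by
      have := hw.1
      rwa [Metric.mem_ball, Subtype.dist_eq, dist_eq_norm] at this
    have hu1 : ‖(u : ℂ)‖ = 1 := mem_sphere_zero_iff_norm.1 u.2
    change ‖cut ε N (Y ω) - z‖ < δ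
    have e3 : cut ε N (Y ω) - z = (x : ℂ) * ((w : ℂ) - u) + ((x - ‖z‖ : ℝ) : ℂ) * u := by
      rw [e1]
      conv_lhs => rw [e2]
      push_cast
      ring
    rw [e3]
    refine (norm_add_le _ _).trans_lt ?_
    rw [norm_mul, norm_mul, hu1, Complex.norm_real, Complex.norm_real, Real.norm_of_nonneg hx0.le,
      mul_one, Real.norm_eq_abs]
    have h7 := hs5 x ⟨hx1, hx2⟩
    have h8 : x * ‖(w : ℂ) - u‖ ≤ ε⁻¹ * (ε * (δ / 2)) :=
      mul_le_mul (hx2.trans hs4) hwu.le (norm_nonneg _) (by positivity)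
    rw [inv_mul_cancel_left₀ hε.ne'] at h8
    linarith
  have hmain : P.real (E (s * √(N : ℝ))) ≤
      P.real {ω | ‖cut ε N (Y ω) - z‖ < δ} + P.real (E (s' * √(N : ℝ))) :=
    (measureReal_mono hsub).trans (measureReal_union_le _ _)
  rw [hE _ h5, hE _ h6] at hmain
  have h9 : Real.exp (-κ₂ * speed α N) ≤ 1 / 2 * Real.exp (-κ₁ * speed α N) := by
    have : Real.exp (-κ₂ * speed α N) =
        Real.exp (-(κ₂ - κ₁) * speed α N) * Real.exp (-κ₁ * speed α N) := by
      rw [← Real.exp_add]; congr 1; ring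
    rw [this]
    gcongr
  have h10 : Real.exp (-κ * speed α N) ≤ ν.real V / 2 * Real.exp (-κ₁ * speed α N) := by
    have : Real.exp (-κ * speed α N) =
        Real.exp (-(κ - κ₁) * speed α N) * Real.exp (-κ₁ * speed α N) := by
      rw [← Real.exp_add]; congr 1; ring
    rw [this]
    gcongr
  have h11 := mul_le_mul_of_nonneg_left h1 hVr.le
  have h12 := mul_le_mul_of_nonneg_left (h2.trans h9) hVr.le
  linarith

end tails

section matrices

variable {Ω : Type*} [MeasurableSpace Ω] {P : Measure Ω} [IsProbabilityMeasure P]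
  {X : ℕ → ℕ → Ω → ℂ} {α a b ε : ℝ} {ν₁ ν₂ : Measure (Metric.sphere (0 : ℂ) 1)}
  {r : ℕ}

/-! ## Basic facts about the array and its cut-off -/

lemma cutMatrix_apply (N : ℕ) (ω : Ω) (i j : ℕ) :
    cutMatrix X ε N ω i j = if i < N ∧ j < N then cut ε N (X i j ω) else 0 := by
  unfold cutMatrix cut
  by_cases h : i < N ∧ j < N <;> simp [h]

lemma inBlock_cutMatrix (N : ℕ) (ω : Ω) : InBlock N (cutMatrix X ε N ω) := by
  intro i j hij
  rw [cutMatrix_apply, if_neg (by omega)]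

lemma IsWigner.norm_swap (hX : IsWigner P X) (i j : ℕ) (ω : Ω) : ‖X j i ω‖ = ‖X i j ω‖ := by
  rw [hX.hermitian i j ω, norm_star]

lemma IsWigner.cutMatrix_swap (hX : IsWigner P X) (N : ℕ) (ω : Ω) (i j : ℕ) :
    cutMatrix X ε N ω j i = star (cutMatrix X ε N ω i j) := by
  rw [cutMatrix_apply, cutMatrix_apply, hX.hermitian i j ω, cut_star]
  by_cases h : i < N ∧ j < N
  · rw [if_pos h, if_pos h.symm]
  · rw [if_neg h, if_neg (fun h' => h h'.symm), star_zero]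

/-- The cut-off matrix as a point of a product space. -/
noncomputable def cutArray (X : ℕ → ℕ → Ω → ℂ) (ε : ℝ) (N : ℕ) (ω : Ω) : ℕ → ℕ → ℂ :=
  fun i j => cutMatrix X ε N ω i j

lemma IsWigner.measurable_cutArray (hX : IsWigner P X) (ε : ℝ) (N : ℕ) :
    Measurable (cutArray X ε N) := by
  refine measurable_pi_iff.2 fun i => measurable_pi_iff.2 fun j => ?_
  simp only [cutArray, cutMatrix_apply]
  by_cases h : i < N ∧ j < N
  · simp only [if_pos h]
    exact (measurable_cut ε N).comp (hX.measurable i j)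
  · simp [h]

lemma sparseEvent_eq (N : ℕ) :
    sparseEvent X ε r N = cutArray X ε N ⁻¹' blockSparse r N := by
  ext ω
  exact ⟨fun h => ⟨h, inBlock_cutMatrix N ω⟩, fun h => h.1⟩

lemma sparseCut_eq {N : ℕ} {ω : Ω} (h : IsSparse r (cutMatrix X ε N ω)) :
    sparseCut X ε r N ω = proj ⟨cutMatrix X ε N ω, h⟩ := dif_pos h

lemma IsWigner.measurableSet_sparseEvent (hX : IsWigner P X) (N : ℕ) :
    MeasurableSet (sparseEvent X ε r N) := by
  rw [sparseEvent_eq]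
  exact hX.measurable_cutArray ε N (isClosed_blockSparse r N).measurableSet

/-- The map factors through the array of cut entries, followed by a function continuous on the
closed set `blockSparse r N` and constant off it. -/
lemma IsWigner.measurable_sparseCut (hX : IsWigner P X) (N : ℕ) :
    Measurable (sparseCut X ε r N) := by
  classical
  have h1 : Measurable ((blockSparse r N).piecewise (classOf r)
      fun _ => proj ⟨0, isSparse_zero r⟩) :=
    (continuousOn_classOf r N).measurable_piecewise continuousOn_const
      (isClosed_blockSparse r N).measurableSet
  have h2 : sparseCut X ε r N = ((blockSparse r N).piecewise (classOf r)
      fun _ => proj ⟨0, isSparse_zero r⟩) ∘ cutArray X ε N := by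
    funext ω
    by_cases h : IsSparse r (cutMatrix X ε N ω)
    · have h' : cutArray X ε N ω ∈ blockSparse r N := ⟨h, inBlock_cutMatrix N ω⟩
      rw [Function.comp_apply, Set.piecewise_eq_of_mem _ _ _ h']
      rfl
    · have h' : cutArray X ε N ω ∉ blockSparse r N := fun h' => h h'.1
      rw [Function.comp_apply, Set.piecewise_eq_of_notMem _ _ _ h']
      exact dif_neg h
  rw [h2]
  exact h1.comp (hX.measurable_cutArray ε N)

lemma IsWigner.condLaw_apply (hX : IsWigner P X) (N : ℕ) {B : Set (SparseClass r)}
    (hB : MeasurableSet B) : condLaw P X ε r N B =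
      (P (sparseEvent X ε r N))⁻¹ * P (sparseEvent X ε r N ∩ sparseCut X ε r N ⁻¹' B) := by
  rw [condLaw, Measure.map_apply (hX.measurable_sparseCut N) hB,
    cond_apply (hX.measurableSet_sparseEvent N)]

/-- Independence of the entries in distinct positions of the upper triangle. -/
lemma IsWigner.measureReal_forall_mem (hX : IsWigner P X) {ι : Type*} [Fintype ι]
    (q : ι → ℕ × ℕ) (hq : q.Injective) (hle : ∀ i, (q i).1 ≤ (q i).2) (G : ι → Set ℂ)
    (hG : ∀ i, MeasurableSet (G i)) :
    P.real {ω | ∀ i, X (q i).1 (q i).2 ω ∈ G i} =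
      ∏ i, P.real {ω | X (q i).1 (q i).2 ω ∈ G i} := by
  let g : ι → {p : ℕ × ℕ // p.1 ≤ p.2} := fun i => ⟨q i, hle i⟩
  have hg : g.Injective := fun i j h => hq (congrArg Subtype.val h)
  have h := (hX.indep.precomp hg).measure_inter_preimage_eq_mul Finset.univ (sets := G)
    fun i _ => hG i
  simp only [measureReal_def, ← ENNReal.toReal_prod]
  congr 1
  refine Eq.trans (congrArg P ?_) h
  ext ω
  simp [g]

lemma IsWigner.measureReal_off (hX : IsWigner P X) {i j : ℕ} (hij : i < j) {G : Set ℂ}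
    (hG : MeasurableSet G) : P.real {ω | X i j ω ∈ G} = P.real {ω | X 0 1 ω ∈ G} :=
  congrArg ENNReal.toReal ((hX.identDistrib_off i j hij).measure_mem_eq hG)

lemma IsWigner.measureReal_diag (hX : IsWigner P X) (i : ℕ) {G : Set ℂ}
    (hG : MeasurableSet G) : P.real {ω | X i i ω ∈ G} = P.real {ω | X 0 0 ω ∈ G} :=
  congrArg ENNReal.toReal ((hX.identDistrib_diag i).measure_mem_eq hG)

lemma measurableSet_le_norm (t : ℝ) : MeasurableSet {z : ℂ | t ≤ ‖z‖} :=
  (isClosed_le continuous_const continuous_norm).measurableSet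

/-! ### Consequences of the tail assumption for the entries -/

section tailAssumption

variable [IsProbabilityMeasure ν₁] [IsProbabilityMeasure ν₂]

lemma TailAssumption.axisPoints_diag (hX : TailAssumption P X α a b ν₁ ν₂) :
    ν₁ axisPointsᶜ = 0 :=
  hX.angle_diag.axisPoints_of_real
    (fun ω => Complex.conj_eq_iff_im.1 (hX.isWigner.hermitian 0 0 ω).symm) hX.b_pos hX.tail_diag

lemma TailAssumption.axisPoints_off (hX : TailAssumption P X α a b ν₁ ν₂) :
    ν₂ axisPointsᶜ = 0 :=
  hX.angle_off.axisPoints_of_indep hX.α_pos hX.α_lt_two hX.a_pos hX.indep_re_im hX.tail_off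

lemma TailAssumption.tailWeight_pos (hX : TailAssumption P X α a b ν₁ ν₂) (p : ℕ × ℕ) :
    0 < tailWeight a b p := by
  unfold tailWeight
  split_ifs
  exacts [hX.b_pos, hX.a_pos]

/-- Upper bound for the tails of the entries, uniform in the position. -/
lemma TailAssumption.eventually_entry_le (hX : TailAssumption P X α a b ν₁ ν₂) (p : ℕ × ℕ)
    {s κ : ℝ} (hs : 0 < s) (hκ : κ < tailWeight a b p * s ^ α) :
    ∀ᶠ N : ℕ in atTop, ∀ i j, i ≤ j → (i = j ↔ p.1 = p.2) →
      P.real {ω | s * √(N : ℝ) ≤ ‖X i j ω‖} ≤ Real.exp (-κ * speed α N) := by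
  by_cases hp : p.1 = p.2
  · rw [tailWeight, if_pos hp] at hκ
    filter_upwards [hX.tail_diag.eventually_speed_le hX.α_pos hX.b_pos hs hκ] with N hN i j hij h
    obtain rfl := h.2 hp
    exact (hX.isWigner.measureReal_diag i (measurableSet_le_norm (s * √(N : ℝ)))).trans_le hN
  · rw [tailWeight, if_neg hp] at hκ
    filter_upwards [hX.tail_off.eventually_speed_le hX.α_pos hX.a_pos hs hκ] with N hN i j hij h
    have : i < j := hij.lt_of_ne fun h' => hp (h.1 h')
    exact (hX.isWigner.measureReal_off this (measurableSet_le_norm (s * √(N : ℝ)))).trans_le hN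

/-- The probability that an entry survives the cut-off is small, uniformly in the position. -/
lemma TailAssumption.exists_eventually_cut_ne_zero_le (hX : TailAssumption P X α a b ν₁ ν₂)
    (hε : 0 < ε) : ∃ κ : ℝ, 0 < κ ∧ ∀ᶠ N : ℕ in atTop, ∀ i j, i ≤ j →
      P.real {ω | cut ε N (X i j ω) ≠ 0} ≤ Real.exp (-κ * speed α N) := by
  have hεα : 0 < ε ^ α := Real.rpow_pos_of_pos hε _
  have h0 := mul_pos (hX.tailWeight_pos (0, 0)) hεα
  have h1 := mul_pos (hX.tailWeight_pos (0, 1)) hεα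
  obtain ⟨κ, hκ0, hκ⟩ := exists_between (lt_min h0 h1)
  refine ⟨κ, hκ0, ?_⟩
  filter_upwards [hX.eventually_entry_le (0, 0) hε (hκ.trans_le (min_le_left _ _)),
    hX.eventually_entry_le (0, 1) hε (hκ.trans_le (min_le_right _ _))] with N hd ho i j hij
  refine (measureReal_mono fun ω hω => le_norm_of_cut_ne_zero hω).trans ?_
  by_cases h : i = j
  · exact hd i j hij (by simp [h])
  · exact ho i j hij (by simp [h])

/-- Lower bound for the probability that an entry is close to an admissible value. -/
lemma TailAssumption.eventually_entry_near (hX : TailAssumption P X α a b ν₁ ν₂) (hε : 0 < ε)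
    (hε1 : ε ≠ 1) {A : Sparse r} (hA : A ∈ domain ε ν₁ ν₂ r) {p : ℕ × ℕ} (hp : p.1 ≤ p.2)
    (hp0 : A.entry p.1 p.2 ≠ 0) {δ κ : ℝ} (hδ : 0 < δ)
    (hκ : tailWeight a b p * ‖A.entry p.1 p.2‖ ^ α < κ) :
    ∀ᶠ N : ℕ in atTop, Real.exp (-κ * speed α N) ≤
      P.real {ω | ‖cut ε N (X p.1 p.2 ω) - A.entry p.1 p.2‖ < δ} := by
  have hG : ∀ N, MeasurableSet {z : ℂ | ‖cut ε N z - A.entry p.1 p.2‖ < δ} := fun N =>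
    ((measurable_cut ε N).sub_const _).norm measurableSet_Iio
  obtain ⟨i, j⟩ := p
  dsimp only at hp hp0 hκ hG ⊢
  rcases hp.eq_or_lt with rfl | h
  · rw [tailWeight, if_pos rfl] at hκ
    filter_upwards [hX.angle_diag.eventually_cut_near hX.α_pos hX.b_pos hX.axisPoints_diag
      hX.tail_diag hε hε1 (hA.1 i) hp0 hδ hκ] with N hN
    exact hN.trans_eq (hX.isWigner.measureReal_diag i (hG N)).symm
  · rw [tailWeight, if_neg h.ne] at hκ
    filter_upwards [hX.angle_off.eventually_cut_near hX.α_pos hX.a_pos hX.axisPoints_off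
      hX.tail_off hε hε1 (hA.2 i j h) hp0 hδ hκ] with N hN
    exact hN.trans_eq (hX.isWigner.measureReal_off h (hG N)).symm

/-- Almost surely, for large `N`, the class of a sparse cut-off matrix meets the domain. -/
lemma TailAssumption.ae_sparseCut_mem (hX : TailAssumption P X α a b ν₁ ν₂) (hε : 0 < ε) :
    ∀ᶠ N : ℕ in atTop, ∀ᵐ ω ∂P, ω ∈ sparseEvent X ε r N →
      sparseCut X ε r N ω ∈ proj '' domain ε ν₁ ν₂ r := by
  filter_upwards [hX.angle_diag.ae_admissible hX.axisPoints_diag hε,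
    hX.angle_off.ae_admissible hX.axisPoints_off hε] with N hd ho
  have hm : ∀ ν : Measure (Metric.sphere (0 : ℂ) 1),
      MeasurableSet {z : ℂ | AdmissibleEntry ε ν (cut ε N z)} := fun ν =>
    measurable_cut ε N (isClosed_admissibleEntry hε ν).measurableSet
  have h1 : ∀ᵐ ω ∂P, ∀ i, AdmissibleEntry ε ν₁ (cut ε N (X i i ω)) := ae_all_iff.2 fun i =>
    (hX.isWigner.identDistrib_diag i).symm.ae_mem_snd (hm ν₁) hd
  have h2 : ∀ᵐ ω ∂P, ∀ i j, i < j → AdmissibleEntry ε ν₂ (cut ε N (X i j ω)) :=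
    ae_all_iff.2 fun i => ae_all_iff.2 fun j => by
      by_cases h : i < j
      · filter_upwards [(hX.isWigner.identDistrib_off i j h).symm.ae_mem_snd (hm ν₂) ho]
          with ω hω _ using hω
      · exact Eventually.of_forall fun ω h' => absurd h' h
  filter_upwards [h1, h2] with ω h1 h2 hω
  refine ⟨⟨cutMatrix X ε N ω, hω⟩, ⟨fun i => ?_, fun i j hij => ?_⟩, (sparseCut_eq hω).symm⟩
  · dsimp only
    rw [cutMatrix_apply]
    split_ifs
    exacts [h1 i, Or.inl rfl]
  · dsimp only
    rw [cutMatrix_apply]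
    split_ifs
    exacts [h2 i j hij, Or.inl rfl]

/-! ## Local lower bound -/

/-- Lower bound for the probability that the cut-off matrix is sparse with a class close to that
of an admissible matrix. -/
lemma TailAssumption.eventually_near_ge (hX : TailAssumption P X α a b ν₁ ν₂) (hε : 0 < ε)
    (hε1 : ε ≠ 1) {A : Sparse r} (hA : A ∈ domain ε ν₁ ν₂ r) (hAb : InBlock r A.entry)
    {δ κ : ℝ} (hδ : 0 < δ) (hκ : blockEnergy α a b r A.entry < κ) :
    ∀ᶠ N : ℕ in atTop, Real.exp (-κ * speed α N) ≤
      P.real (sparseEvent X ε r N ∩ sparseCut X ε r N ⁻¹' Metric.ball (proj A) δ) := by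
  classical
  have hα := hX.α_pos
  set T := (upperPairs r).filter fun p => A.entry p.1 p.2 ≠ 0 with hT
  have hE : blockEnergy α a b r A.entry =
      ∑ p ∈ T, tailWeight a b p * ‖A.entry p.1 p.2‖ ^ α := by
    rw [hT, Finset.sum_filter_of_ne]
    · rfl
    · intro p _ h h0
      simp [h0, hα.ne'] at h
  -- The gap between the energy and `κ` is shared out as a loss `η` for each nonzero entry, with
  -- something left to absorb the factor `1 / 2`.
  obtain ⟨η, hη0, hη⟩ : ∃ η : ℝ, 0 < η ∧ blockEnergy α a b r A.entry + T.card * η < κ := by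
    refine ⟨(κ - blockEnergy α a b r A.entry) / (T.card + 1), by
      have := sub_pos.2 hκ; positivity, ?_⟩
    have h1 : (0 : ℝ) < T.card + 1 := by positivity
    have h2 : (T.card : ℝ) / (T.card + 1) < 1 := (div_lt_one h1).2 (by linarith)
    have h3 := mul_lt_mul_of_pos_right h2 (sub_pos.2 hκ)
    have e : (T.card : ℝ) * ((κ - blockEnergy α a b r A.entry) / (T.card + 1)) =
      T.card / (T.card + 1) * (κ - blockEnergy α a b r A.entry) := by ring
    rw [e]
    linarith
  obtain ⟨κ₀, hκ0, hzero⟩ := hX.exists_eventually_cut_ne_zero_le hε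
  have hnear : ∀ᶠ N : ℕ in atTop, ∀ p ∈ T,
      Real.exp (-(tailWeight a b p * ‖A.entry p.1 p.2‖ ^ α + η) * speed α N) ≤
        P.real {ω | ‖cut ε N (X p.1 p.2 ω) - A.entry p.1 p.2‖ < δ / 2} := by
    rw [Filter.eventually_all_finset]
    intro p hp
    rw [hT, Finset.mem_filter, mem_upperPairs] at hp
    exact hX.eventually_entry_near hε hε1 hA hp.1.1 hp.2 (half_pos hδ) (by linarith)
  filter_upwards [hzero, hnear, eventually_ge_atTop r,
    eventually_pow_mul_exp_speed_le 2 hα hκ0 (half_pos one_pos),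
    eventually_exp_speed_le hα (sub_pos.2 hη) (half_pos one_pos),
    eventually_exp_speed_le hα hκ0 one_pos] with N hz hn hrN hN2 hhalf hq1
  -- Where `A` vanishes the cut entry must be exactly `0`, not merely small; otherwise the matrix
  -- could have more than `r` nonzero entries.
  let G : ℕ × ℕ → Set ℂ := fun p =>
    {z | ‖cut ε N z - A.entry p.1 p.2‖ < δ / 2 ∧ (A.entry p.1 p.2 = 0 → cut ε N z = 0)}
  have hGm : ∀ p, MeasurableSet (G p) := fun p => by
    have h2 : MeasurableSet {z : ℂ | A.entry p.1 p.2 = 0 → cut ε N z = 0} := by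
      by_cases h : A.entry p.1 p.2 = 0
      · simp only [h, forall_const]
        exact measurable_cut ε N (measurableSet_singleton 0)
      · simp [h]
    exact (((measurable_cut ε N).sub_const _).norm measurableSet_Iio).inter h2
  set q := Real.exp (-κ₀ * speed α N) with hq
  have hq0 : 0 < q := Real.exp_pos _
  have hprob := hX.isWigner.measureReal_forall_mem (ι := {p // p ∈ upperPairs N})
    (fun p => p.1) Subtype.val_injective (fun p => (mem_upperPairs.1 p.2).1)
    (fun p => G p.1) (fun p => hGm p.1)
  rw [Finset.prod_coe_sort (upperPairs N) fun p => P.real {ω | X p.1 p.2 ω ∈ G p}] at hprob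
  have hsub : {ω | ∀ p : {p // p ∈ upperPairs N}, X p.1.1 p.1.2 ω ∈ G p.1} ⊆
      sparseEvent X ε r N ∩ sparseCut X ε r N ⁻¹' Metric.ball (proj A) δ := by
    intro ω hω
    have hup : ∀ i j, i ≤ j → ‖cutMatrix X ε N ω i j - A.entry i j‖ ≤ δ / 2 ∧
        (A.entry i j = 0 → cutMatrix X ε N ω i j = 0) := by
      intro i j hij
      rw [cutMatrix_apply]
      by_cases hj : j < N
      · rw [if_pos ⟨hij.trans_lt hj, hj⟩]
        have := hω ⟨(i, j), mem_upperPairs.2 ⟨hij, hj⟩⟩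
        exact ⟨this.1.le, this.2⟩
      · rw [if_neg (by omega), hAb i j (by omega)]
        simpa using (half_pos hδ).le
    have hall : ∀ i j, ‖cutMatrix X ε N ω i j - A.entry i j‖ ≤ δ / 2 ∧
        (A.entry i j = 0 → cutMatrix X ε N ω i j = 0) := by
      intro i j
      rcases le_total i j with hij | hij
      · exact hup i j hij
      · have := hup j i hij
        rw [hX.isWigner.cutMatrix_swap N ω j i, A.entry_swap j i, ← star_sub, norm_star]
        simpa using this
    have hsp : IsSparse r (cutMatrix X ε N ω) := by
      refine ⟨Matrix.IsHermitian.ext fun i j => (hX.isWigner.cutMatrix_swap N ω j i).symm,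
        (Set.encard_le_encard fun p hp => ?_).trans A.isSparse.2⟩
      exact fun h0 => hp ((hall p.1 p.2).2 h0)
    refine ⟨hsp, ?_⟩
    rw [Set.mem_preimage, Metric.mem_ball, sparseCut_eq hsp, dist_comm, dist_proj]
    exact (orbitDist_le_supDist _ _).trans_lt
      (lt_of_le_of_lt (ciSup_le fun p => (hall p.1 p.2).1) (half_lt_self hδ))
  refine le_trans ?_ (measureReal_mono hsub)
  rw [hprob, ← Finset.prod_filter_mul_prod_filter_not (upperPairs N)
    fun p => A.entry p.1 p.2 ≠ 0]
  have hTN : (upperPairs N).filter (fun p => A.entry p.1 p.2 ≠ 0) = T := by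
    ext p
    simp only [hT, Finset.mem_filter, mem_upperPairs]
    refine ⟨fun h => ⟨⟨h.1.1, ?_⟩, h.2⟩, fun h => ⟨⟨h.1.1, h.1.2.trans_le hrN⟩, h.2⟩⟩
    by_contra hlt
    exact h.2 (hAb _ _ (Or.inr (not_lt.1 hlt)))
  have hprodT : Real.exp (-(blockEnergy α a b r A.entry + T.card * η) * speed α N) ≤
      ∏ p ∈ (upperPairs N).filter (fun p => A.entry p.1 p.2 ≠ 0),
        P.real {ω | X p.1 p.2 ω ∈ G p} := by
    rw [hTN]
    calc Real.exp (-(blockEnergy α a b r A.entry + T.card * η) * speed α N)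
        = ∏ p ∈ T, Real.exp (-(tailWeight a b p * ‖A.entry p.1 p.2‖ ^ α + η) * speed α N) := by
          rw [← Real.exp_sum, ← Finset.sum_mul, Finset.sum_neg_distrib, Finset.sum_add_distrib,
            ← hE, Finset.sum_const, nsmul_eq_mul]
      _ ≤ _ := by
          refine Finset.prod_le_prod (fun p _ => (Real.exp_pos _).le) fun p hp => ?_
          refine (hn p hp).trans (measureReal_mono fun ω hω => ⟨hω, fun h => absurd h ?_⟩)
          exact (Finset.mem_filter.1 hp).2
  -- Bernoulli's inequality: at most `N ^ 2` factors, each at least `1 - q`, with `N ^ 2 * q ≤ 1 /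
  -- 2`.
  have hprodZ : 1 / 2 ≤ ∏ p ∈ (upperPairs N).filter (fun p => ¬ A.entry p.1 p.2 ≠ 0),
      P.real {ω | X p.1 p.2 ω ∈ G p} := by
    set F := (upperPairs N).filter (fun p => ¬ A.entry p.1 p.2 ≠ 0) with hF
    have hcard : (F.card : ℝ) ≤ (N : ℝ) ^ 2 := by
      exact_mod_cast (Finset.card_filter_le _ _).trans (card_upperPairs_le N)
    calc (1 : ℝ) / 2 ≤ 1 + F.card * (-q) := by nlinarith
      _ ≤ (1 + (-q)) ^ F.card := one_add_mul_le_pow (by linarith) _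
      _ = ∏ p ∈ F, (1 - q) := by rw [Finset.prod_const]; ring
      _ ≤ _ := by
          refine Finset.prod_le_prod (fun p _ => by linarith) fun p hp => ?_
          rw [hF, Finset.mem_filter, mem_upperPairs, not_not] at hp
          have hms : MeasurableSet {ω | cut ε N (X p.1 p.2 ω) ≠ 0} :=
            (measurable_cut ε N).comp (hX.isWigner.measurable p.1 p.2)
              (measurableSet_singleton 0).compl
          have h1 : 1 - q ≤ P.real {ω | cut ε N (X p.1 p.2 ω) ≠ 0}ᶜ := by
            rw [probReal_compl_eq_one_sub hms]
            linarith [hz p.1 p.2 hp.1.1]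
          refine h1.trans (measureReal_mono fun ω hω => ?_)
          have h0 : cut ε N (X p.1 p.2 ω) = 0 := not_not.1 hω
          refine ⟨?_, fun _ => h0⟩
          rw [h0, hp.2]
          simpa using hδ
  calc Real.exp (-κ * speed α N)
      = Real.exp (-(blockEnergy α a b r A.entry + T.card * η) * speed α N) *
        Real.exp (-(κ - (blockEnergy α a b r A.entry + T.card * η)) * speed α N) := by
        rw [← Real.exp_add]; congr 1; ring
    _ ≤ _ := mul_le_mul hprodT (hhalf.trans hprodZ) (Real.exp_pos _).le
        ((Real.exp_pos _).le.trans hprodT)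

/-- The zero matrix is admissible with energy `0`, so the local lower bound around it shows that
conditioning costs nothing on the exponential scale. -/
lemma TailAssumption.eventually_sparseEvent_ge (hX : TailAssumption P X α a b ν₁ ν₂)
    (hε : 0 < ε) (hε1 : ε ≠ 1) (r : ℕ) {κ : ℝ} (hκ : 0 < κ) :
    ∀ᶠ N : ℕ in atTop, Real.exp (-κ * speed α N) ≤ P.real (sparseEvent X ε r N) := by
  have h0 : blockEnergy α a b r (⟨0, isSparse_zero r⟩ : Sparse r).entry < κ := by
    have : blockEnergy α a b r (⟨0, isSparse_zero r⟩ : Sparse r).entry = 0 :=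
      Finset.sum_eq_zero fun p _ => by simp [hX.α_pos.ne']
    rwa [this]
  filter_upwards [hX.eventually_near_ge hε hε1
    (A := ⟨0, isSparse_zero r⟩) ⟨fun _ => Or.inl rfl, fun _ _ _ => Or.inl rfl⟩
    (fun _ _ _ => rfl) one_pos h0] with N hN
  exact hN.trans (measureReal_mono Set.inter_subset_left)

/-! ## Local upper bound -/

/-- Upper bound for the probability that the cut-off matrix is sparse with a class close to that
of an admissible matrix. -/
lemma TailAssumption.exists_eventually_near_le (hX : TailAssumption P X α a b ν₁ ν₂) (hε : 0 < ε)
    {A : Sparse r} (hA : A ∈ domain ε ν₁ ν₂ r) (hAb : InBlock r A.entry)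
    {κ : ℝ} (hκ : κ < blockEnergy α a b r A.entry) :
    ∃ δ : ℝ, 0 < δ ∧ ∀ᶠ N : ℕ in atTop,
      P.real (sparseEvent X ε r N ∩ sparseCut X ε r N ⁻¹' Metric.ball (proj A) δ) ≤
        Real.exp (-κ * speed α N) := by
  classical
  have hα := hX.α_pos
  set T := (upperPairs r).filter fun p => A.entry p.1 p.2 ≠ 0 with hT
  have hE : blockEnergy α a b r A.entry =
      ∑ p ∈ T, tailWeight a b p * ‖A.entry p.1 p.2‖ ^ α := by
    rw [hT, Finset.sum_filter_of_ne]
    · rfl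
    · intro p _ h h0
      simp [h0, hα.ne'] at h
  have hTε : ∀ p ∈ T, ε ≤ ‖A.entry p.1 p.2‖ := by
    intro p hp
    rw [hT, Finset.mem_filter, mem_upperPairs] at hp
    have hadm : AdmissibleEntry ε ν₁ (A.entry p.1 p.2) ∨ AdmissibleEntry ε ν₂ (A.entry p.1 p.2) := by
      rcases hp.1.1.eq_or_lt with h | h
      · rw [← h]; exact Or.inl (hA.1 _)
      · exact Or.inr (hA.2 _ _ h)
    rcases hadm with h | h <;> exact (h.resolve_left hp.2).1.1
  -- The factor `1 - δ` provides the strict inequality required by `eventually_entry_le`. As `F` is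
  -- continuous with `F 0` equal to the energy, a small `δ` keeps `F δ` above `κ`; taking `δ < ε`
  -- also prevents nonzero entries of `A` from being matched with zeros.
  let F : ℝ → ℝ := fun δ => ∑ p ∈ T, (1 - δ) * (tailWeight a b p * (‖A.entry p.1 p.2‖ - δ) ^ α)
  have hFc : Continuous F := continuous_finsetSum _ fun p _ =>
    (continuous_const.sub continuous_id).mul (continuous_const.mul
      ((continuous_const.sub continuous_id).rpow_const fun _ => Or.inr hα.le))
  have hF0 : κ < F 0 := by simpa [F, ← hE] using hκ
  obtain ⟨δ, ⟨hδF, hδε⟩, hδ0⟩ : ∃ δ : ℝ, (κ < F δ ∧ δ < ε) ∧ 0 < δ :=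
    ((((hFc.continuousAt.eventually_const_lt hF0).and (eventually_lt_nhds hε)).filter_mono
      nhdsWithin_le_nhds).and (self_mem_nhdsWithin : Set.Ioi (0 : ℝ) ∈ 𝓝[>] 0)).exists
  refine ⟨δ, hδ0, ?_⟩
  obtain ⟨R, hRr, hR1, hR2⟩ := A.exists_rows
  have hspos : ∀ p ∈ T, 0 < ‖A.entry p.1 p.2‖ - δ := fun p hp => by linarith [hTε p hp]
  have htail : ∀ᶠ N : ℕ in atTop, ∀ p ∈ T, ∀ i j, i ≤ j → (i = j ↔ p.1 = p.2) →
      P.real {ω | (‖A.entry p.1 p.2‖ - δ) * √(N : ℝ) ≤ ‖X i j ω‖} ≤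
        Real.exp (-((1 - δ) * (tailWeight a b p * (‖A.entry p.1 p.2‖ - δ) ^ α)) *
          speed α N) := by
    rw [Filter.eventually_all_finset]
    intro p hp
    refine hX.eventually_entry_le p (hspos p hp) ?_
    have := mul_pos (hX.tailWeight_pos p) (Real.rpow_pos_of_pos (hspos p hp) α)
    nlinarith
  filter_upwards [htail, eventually_pow_mul_exp_speed_le r hα (sub_pos.2 hδF) one_pos,
    eventually_gt_atTop 0] with N hN hpow hN0
  let ext : (R → Fin N) → ℕ → ℕ := fun f i => if h : i ∈ R then f ⟨i, h⟩ else 0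
  have hext : ∀ f i (h : i ∈ R), ext f i = f ⟨i, h⟩ := fun f i h => by simp [ext, h]
  let E : (R → Fin N) → Set Ω := fun f => {ω | f.Injective ∧ ∀ p ∈ T,
    (‖A.entry p.1 p.2‖ - δ) * √(N : ℝ) ≤ ‖X (ext f p.1) (ext f p.2) ω‖}
  have hsub : sparseEvent X ε r N ∩ sparseCut X ε r N ⁻¹' Metric.ball (proj A) δ ⊆
      ⋃ f ∈ (Finset.univ : Finset (R → Fin N)), E f := by
    rintro ω ⟨hsp, hω⟩
    rw [Set.mem_preimage, Metric.mem_ball, sparseCut_eq hsp] at hω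
    obtain ⟨g, hg, hgA⟩ := exists_relabelling hω
    dsimp only at hgA
    have hlow : ∀ p : ℕ × ℕ, ‖A.entry p.1 p.2‖ - δ < ‖cutMatrix X ε N ω (g p.1) (g p.2)‖ := by
      intro p
      have h1 := hgA p.1 p.2
      rw [norm_sub_rev] at h1
      linarith [norm_sub_norm_le (A.entry p.1 p.2) (cutMatrix X ε N ω (g p.1) (g p.2))]
    have hlarge : ∀ i j, A.entry i j ≠ 0 → ε ≤ ‖A.entry i j‖ := by
      intro i j hij
      rcases le_total i j with h | h
      · exact hTε (i, j) (Finset.mem_filter.2 ⟨mem_upperPairs.2 ⟨h, by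
          by_contra hlt; exact hij (hAb _ _ (Or.inr (not_lt.1 hlt)))⟩, hij⟩)
      · rw [A.norm_entry_swap j i]
        exact hTε (j, i) (Finset.mem_filter.2 ⟨mem_upperPairs.2 ⟨h, by
          by_contra hlt; exact hij (hAb _ _ (Or.inl (not_lt.1 hlt)))⟩,
          A.entry_swap_ne_zero.2 hij⟩)
    have hne : ∀ i j, A.entry i j ≠ 0 → cutMatrix X ε N ω (g i) (g j) ≠ 0 := by
      intro i j hij
      rw [← norm_pos_iff]
      linarith [hlow (i, j), hlarge i j hij]
    -- The cut matrix vanishes outside its `N × N` block, so the nonzero rows of `A` are sent into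
    -- `Fin N`; this leaves at most `N ^ r` relabellings for the union bound.
    have hgN : ∀ i ∈ R, g i < N := by
      intro i hi
      obtain ⟨j, hj⟩ := hR2 i hi
      by_contra hlt
      exact hne i j hj (inBlock_cutMatrix N ω _ _ (Or.inl (not_lt.1 hlt)))
    let f : R → Fin N := fun i => ⟨g i, hgN i i.2⟩
    refine Set.mem_biUnion (x := f) (by simp) ⟨?_, ?_⟩
    · intro i j hij
      exact Subtype.ext (hg (congrArg Fin.val hij))
    · intro p hp
      have hp0 := (Finset.mem_filter.1 hp).2
      obtain ⟨h1, h2⟩ := hR1 _ _ hp0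
      have hc := hne _ _ hp0
      have hl := hlow p
      rw [cutMatrix_apply, if_pos ⟨hgN _ h1, hgN _ h2⟩] at hc hl
      have key : (‖A.entry p.1 p.2‖ - δ) * √(N : ℝ) ≤ ‖X (g p.1) (g p.2) ω‖ := by
        rw [norm_eq_of_cut_ne_zero hc]
        gcongr
      exact key.trans_eq (congrArg₂ (fun i j => ‖X i j ω‖) (hext f _ h1).symm
        (hext f _ h2).symm)
  have hbound : ∀ f : R → Fin N, P.real (E f) ≤ Real.exp (-F δ * speed α N) := by
    intro f
    by_cases hf : f.Injective
    swap
    · have : E f = ∅ := by ext ω; simp [E, hf]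
      rw [this, measureReal_empty]
      exact (Real.exp_pos _).le
    have hinj : ∀ i ∈ R, ∀ j ∈ R, ext f i = ext f j → i = j := by
      intro i hi j hj hij
      rw [hext f i hi, hext f j hj] at hij
      exact congrArg Subtype.val (hf (Fin.ext hij))
    have hTR : ∀ p ∈ T, p.1 ∈ R ∧ p.2 ∈ R := fun p hp => hR1 _ _ (Finset.mem_filter.1 hp).2
    have hTle : ∀ p ∈ T, p.1 ≤ p.2 := fun p hp =>
      (mem_upperPairs.1 (Finset.mem_filter.1 hp).1).1
    -- A relabelling may move a position below the diagonal. Reflecting it back preserves the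
    -- modulus, and distinct positions of `T` stay distinct, so independence applies.
    let q : {p // p ∈ T} → ℕ × ℕ := fun p =>
      (min (ext f p.1.1) (ext f p.1.2), max (ext f p.1.1) (ext f p.1.2))
    have hq : q.Injective := by
      rintro ⟨p, hp⟩ ⟨p', hp'⟩ h
      simp only [q, Prod.mk.injEq] at h
      have hl := hTle p hp
      have hl' := hTle p' hp'
      obtain ⟨h1, h2⟩ := hTR p hp
      obtain ⟨h1', h2'⟩ := hTR p' hp'
      have h3 : (ext f p.1 = ext f p'.1 ∧ ext f p.2 = ext f p'.2) ∨
          (ext f p.1 = ext f p'.2 ∧ ext f p.2 = ext f p'.1) := by omega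
      rcases h3 with ⟨h3, h4⟩ | ⟨h3, h4⟩
      · exact Subtype.ext (Prod.ext (hinj _ h1 _ h1' h3) (hinj _ h2 _ h2' h4))
      · have e1 := hinj _ h1 _ h2' h3
        have e2 := hinj _ h2 _ h1' h4
        exact Subtype.ext (Prod.ext (by dsimp only; omega) (by dsimp only; omega))
    have hind := hX.isWigner.measureReal_forall_mem q hq (fun p => min_le_max)
      (fun p => {z | (‖A.entry p.1.1 p.1.2‖ - δ) * √(N : ℝ) ≤ ‖z‖})
      (fun p => measurableSet_le_norm _)
    have hEsub : E f ⊆ {ω | ∀ p : {p // p ∈ T}, X (q p).1 (q p).2 ω ∈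
        {z | (‖A.entry p.1.1 p.1.2‖ - δ) * √(N : ℝ) ≤ ‖z‖}} := by
      rintro ω ⟨-, hω⟩ ⟨p, hp⟩
      have := hω p hp
      simp only [Set.mem_ofPred_eq, q]
      rcases le_total (ext f p.1) (ext f p.2) with h | h
      · rwa [min_eq_left h, max_eq_right h]
      · rwa [min_eq_right h, max_eq_left h, hX.isWigner.norm_swap]
    calc P.real (E f) ≤ _ := measureReal_mono hEsub
      _ = _ := hind
      _ ≤ ∏ p : {p // p ∈ T}, Real.exp (-((1 - δ) * (tailWeight a b p.1 *
            (‖A.entry p.1.1 p.1.2‖ - δ) ^ α)) * speed α N) := by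
          refine Finset.prod_le_prod (fun p _ => measureReal_nonneg) fun p _ => ?_
          refine hN p.1 p.2 _ _ min_le_max ?_
          refine ⟨fun h => ?_, fun h => by simp [q, h]⟩
          have h' : ext f p.1.1 = ext f p.1.2 := by
            simp only [q] at h
            omega
          exact hinj _ (hTR p.1 p.2).1 _ (hTR p.1 p.2).2 h'
      _ = Real.exp (-F δ * speed α N) := by
          rw [Finset.prod_coe_sort T fun p => Real.exp (-((1 - δ) * (tailWeight a b p *
            (‖A.entry p.1 p.2‖ - δ) ^ α)) * speed α N), ← Real.exp_sum, ← Finset.sum_mul,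
            Finset.sum_neg_distrib]
  have hN1 : (1 : ℝ) ≤ N := by exact_mod_cast hN0
  calc P.real (sparseEvent X ε r N ∩ sparseCut X ε r N ⁻¹' Metric.ball (proj A) δ)
      ≤ P.real (⋃ f ∈ (Finset.univ : Finset (R → Fin N)), E f) :=
        measureReal_mono hsub (measure_ne_top _ _)
    _ ≤ ∑ f : R → Fin N, P.real (E f) := measureReal_biUnion_finset_le _ _
    _ ≤ ∑ f : R → Fin N, Real.exp (-F δ * speed α N) := Finset.sum_le_sum fun f _ => hbound f
    _ = (N : ℝ) ^ R.card * Real.exp (-F δ * speed α N) := by simp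
    _ ≤ (N : ℝ) ^ r * Real.exp (-F δ * speed α N) := by gcongr
    _ = ((N : ℝ) ^ r * Real.exp (-(F δ - κ) * speed α N)) * Real.exp (-κ * speed α N) := by
        rw [mul_assoc, ← Real.exp_add]; congr 2; ring
    _ ≤ Real.exp (-κ * speed α N) := mul_le_of_le_one_left (Real.exp_pos _).le hpow

end tailAssumption

end matrices

section conclusion

variable {Ω : Type*} [MeasurableSpace Ω] {P : Measure Ω} [IsProbabilityMeasure P]
  {X : ℕ → ℕ → Ω → ℂ} {α a b ε : ℝ} {ν₁ ν₂ : Measure (Metric.sphere (0 : ℂ) 1)}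
  [IsProbabilityMeasure ν₁] [IsProbabilityMeasure ν₂] {r : ℕ}

/-! ## Bounds for the conditional laws -/

lemma TailAssumption.exists_eventually_condLaw_ball_le (hX : TailAssumption P X α a b ν₁ ν₂)
    (hε : 0 < ε) (hε1 : ε ≠ 1) {A : Sparse r} (hA : A ∈ domain ε ν₁ ν₂ r)
    (hAb : InBlock r A.entry) {κ : ℝ} (hκ : κ < blockEnergy α a b r A.entry) :
    ∃ δ : ℝ, 0 < δ ∧ ∀ᶠ N : ℕ in atTop,
      condLaw P X ε r N (Metric.ball (proj A) δ) ≤ ENNReal.ofReal (Real.exp (-κ * speed α N)) := by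
  -- The gap `κ' - κ` pays for dividing by the probability of the conditioning event.
  obtain ⟨κ', hκ1, hκ2⟩ := exists_between hκ
  obtain ⟨δ, hδ, h⟩ := hX.exists_eventually_near_le hε hA hAb hκ2
  refine ⟨δ, hδ, ?_⟩
  filter_upwards [h, hX.eventually_sparseEvent_ge hε hε1 r (sub_pos.2 hκ1)] with N h1 h2
  rw [hX.isWigner.condLaw_apply N Metric.isOpen_ball.measurableSet]
  have h1' : P (sparseEvent X ε r N ∩ sparseCut X ε r N ⁻¹' Metric.ball (proj A) δ) ≤
      ENNReal.ofReal (Real.exp (-κ' * speed α N)) := by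
    rw [← ofReal_measureReal]
    exact ENNReal.ofReal_le_ofReal h1
  have h2' : ENNReal.ofReal (Real.exp (-(κ' - κ) * speed α N)) ≤ P (sparseEvent X ε r N) := by
    rw [← ofReal_measureReal]
    exact ENNReal.ofReal_le_ofReal h2
  refine (mul_le_mul' (ENNReal.inv_le_inv.2 h2') h1').trans (le_of_eq ?_)
  rw [← ENNReal.ofReal_inv_of_pos (Real.exp_pos _), ← ENNReal.ofReal_mul (by positivity),
    ← Real.exp_neg, ← Real.exp_add]
  congr 2
  ring

/-- Dividing by a probability can only increase the local lower bound. -/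
lemma TailAssumption.eventually_condLaw_ball_ge (hX : TailAssumption P X α a b ν₁ ν₂)
    (hε : 0 < ε) (hε1 : ε ≠ 1) {A : Sparse r} (hA : A ∈ domain ε ν₁ ν₂ r)
    (hAb : InBlock r A.entry) {δ κ : ℝ} (hδ : 0 < δ) (hκ : blockEnergy α a b r A.entry < κ) :
    ∀ᶠ N : ℕ in atTop,
      ENNReal.ofReal (Real.exp (-κ * speed α N)) ≤ condLaw P X ε r N (Metric.ball (proj A) δ) := by
  filter_upwards [hX.eventually_near_ge hε hε1 hA hAb hδ hκ] with N hN
  rw [hX.isWigner.condLaw_apply N Metric.isOpen_ball.measurableSet]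
  calc ENNReal.ofReal (Real.exp (-κ * speed α N))
      ≤ P (sparseEvent X ε r N ∩ sparseCut X ε r N ⁻¹' Metric.ball (proj A) δ) := by
        rw [← ofReal_measureReal]
        exact ENNReal.ofReal_le_ofReal hN
    _ = 1 * P (sparseEvent X ε r N ∩ sparseCut X ε r N ⁻¹' Metric.ball (proj A) δ) :=
        (one_mul _).symm
    _ ≤ _ := by
        gcongr
        exact ENNReal.one_le_inv.2 prob_le_one

/-- Asymptotically, the conditional laws live on the classes that meet the domain. -/
lemma TailAssumption.eventually_condLaw_compl (hX : TailAssumption P X α a b ν₁ ν₂)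
    (hε : 0 < ε) : ∀ᶠ N : ℕ in atTop,
      condLaw P X ε r N (proj '' domain ε ν₁ ν₂ r)ᶜ = 0 := by
  filter_upwards [hX.ae_sparseCut_mem (r := r) hε] with N hN
  have hcl : IsClosed (proj '' domain ε ν₁ ν₂ r) :=
    (isCompact_proj_domain hX.α_pos hX.a_pos.le hX.b_pos.le hε).isClosed
  rw [hX.isWigner.condLaw_apply N hcl.measurableSet.compl]
  refine mul_eq_zero_of_right _ (measure_mono_null (fun ω hω => ?_) hN)
  exact fun h => hω.2 (h hω.1)

lemma rate_proj_eq (hα : 0 < α) (ha : 0 ≤ a) (hb : 0 ≤ b) {A : Sparse r}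
    (hA : A ∈ domain ε ν₁ ν₂ r) (hAb : InBlock r A.entry) :
    ((rate α a b ε ν₁ ν₂ r (proj A) : ℝ≥0∞) : EReal) = (blockEnergy α a b r A.entry : ℝ) := by
  have h0 : 0 ≤ blockEnergy α a b r A.entry := Finset.sum_nonneg fun p _ => by
    unfold tailWeight
    split_ifs <;> positivity
  rw [rate_proj_of_mem hA, energy_eq_blockEnergy hα ha hb A hAb, EReal.coe_ennreal_ofReal,
    max_eq_left h0]

/-- Exponential upper bound for the conditional laws of a closed set. -/
lemma TailAssumption.eventually_condLaw_closure_le (hX : TailAssumption P X α a b ν₁ ν₂)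
    (hε : 0 < ε) (hε1 : ε ≠ 1) (B : Set (SparseClass r)) {κ : ℝ}
    (hκ : (κ : EReal) < ((⨅ x ∈ closure B, rate α a b ε ν₁ ν₂ r x : ℝ≥0∞) : EReal)) :
    ∀ᶠ N : ℕ in atTop,
      condLaw P X ε r N B ≤ ENNReal.ofReal (Real.exp (-κ * speed α N)) := by
  have hα := hX.α_pos
  obtain ⟨κ', hκ1, hκ2⟩ := EReal.lt_iff_exists_real_btwn.1 hκ
  have hκ1 : κ < κ' := EReal.coe_lt_coe_iff.1 hκ1
  have hD : IsCompact (proj '' domain ε ν₁ ν₂ r) :=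
    isCompact_proj_domain hα hX.a_pos.le hX.b_pos.le hε
  have hK : IsCompact (closure B ∩ proj '' domain ε ν₁ ν₂ r) := hD.inter_left isClosed_closure
  obtain ⟨n, hn⟩ : ∃ n : ℕ, ∀ᶠ N : ℕ in atTop,
      condLaw P X ε r N (closure B ∩ proj '' domain ε ν₁ ν₂ r) ≤
        n * ENNReal.ofReal (Real.exp (-κ' * speed α N)) := by
    -- The bound with an unspecified constant `n` is stable under subsets and finite unions, so by
    -- compactness a ball around each point suffices. The gap between `κ` and `κ'` later absorbs
    -- `n`.
    refine hK.induction_on (p := fun S => ∃ n : ℕ, ∀ᶠ N : ℕ in atTop, condLaw P X ε r N S ≤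
        n * ENNReal.ofReal (Real.exp (-κ' * speed α N))) ⟨0, by simp⟩ ?_ ?_ ?_
    · rintro S S' hSS' ⟨n, hn⟩
      exact ⟨n, hn.mono fun N h => (measure_mono hSS').trans h⟩
    · rintro S S' ⟨n, hn⟩ ⟨n', hn'⟩
      refine ⟨n + n', ?_⟩
      filter_upwards [hn, hn'] with N h h'
      push_cast
      rw [add_mul]
      exact (measure_union_le _ _).trans (add_le_add h h')
    · rintro x ⟨hxB, hxD⟩
      obtain ⟨A, hA, hAb, rfl⟩ := exists_rep_inBlock hxD
      have hlt : κ' < blockEnergy α a b r A.entry := by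
        rw [← EReal.coe_lt_coe_iff, ← rate_proj_eq hα hX.a_pos.le hX.b_pos.le hA hAb]
        exact hκ2.trans_le (EReal.coe_ennreal_le_coe_ennreal_iff.2 (iInf₂_le _ hxB))
      obtain ⟨δ, hδ, h⟩ := hX.exists_eventually_condLaw_ball_le hε hε1 hA hAb hlt
      exact ⟨_, nhdsWithin_le_nhds (Metric.ball_mem_nhds _ hδ), 1, by simpa using h⟩
  filter_upwards [hn, hX.eventually_condLaw_compl (r := r) hε,
    eventually_exp_speed_le hα (sub_pos.2 hκ1) (C := ((n : ℝ) + 1)⁻¹) (by positivity)]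
    with N h1 h2 h3
  have hsub : B ⊆ (closure B ∩ proj '' domain ε ν₁ ν₂ r) ∪ (proj '' domain ε ν₁ ν₂ r)ᶜ := by
    intro x hx
    by_cases h : x ∈ proj '' domain ε ν₁ ν₂ r
    · exact Or.inl ⟨subset_closure hx, h⟩
    · exact Or.inr h
  refine (measure_mono hsub).trans ((measure_union_le _ _).trans ?_)
  rw [h2, add_zero]
  refine h1.trans ?_
  rw [← ENNReal.ofReal_natCast, ← ENNReal.ofReal_mul (Nat.cast_nonneg n)]
  refine ENNReal.ofReal_le_ofReal ?_
  have e : Real.exp (-κ' * speed α N) =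
      Real.exp (-(κ' - κ) * speed α N) * Real.exp (-κ * speed α N) := by
    rw [← Real.exp_add]; congr 1; ring
  rw [e, ← mul_assoc]
  refine mul_le_of_le_one_left (Real.exp_pos _).le ?_
  calc (n : ℝ) * Real.exp (-(κ' - κ) * speed α N) ≤ (n + 1) * ((n : ℝ) + 1)⁻¹ := by
        gcongr
        linarith
    _ = 1 := mul_inv_cancel₀ (by positivity)

/-! ## The large deviations principle -/

lemma inv_mul_log_le {v κ : ℝ} (hv : 0 < v) {m : ℝ≥0∞}
    (h : m ≤ ENNReal.ofReal (Real.exp (-κ * v))) :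
    ((v⁻¹ : ℝ) : EReal) * ENNReal.log m ≤ ((-κ : ℝ) : EReal) := by
  have h1 := ENNReal.log_le_log h
  rw [ENNReal.log_ofReal_of_pos (Real.exp_pos _), Real.log_exp] at h1
  refine (mul_le_mul_of_nonneg_left h1 (EReal.coe_nonneg.2 (inv_pos.2 hv).le)).trans_eq ?_
  rw [← EReal.coe_mul]
  congr 1
  field_simp

lemma le_inv_mul_log {v κ : ℝ} (hv : 0 < v) {m : ℝ≥0∞}
    (h : ENNReal.ofReal (Real.exp (-κ * v)) ≤ m) :
    ((-κ : ℝ) : EReal) ≤ ((v⁻¹ : ℝ) : EReal) * ENNReal.log m := by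
  have h1 := ENNReal.log_le_log h
  rw [ENNReal.log_ofReal_of_pos (Real.exp_pos _), Real.log_exp] at h1
  refine le_trans (le_of_eq ?_)
    (mul_le_mul_of_nonneg_left h1 (EReal.coe_nonneg.2 (inv_pos.2 hv).le))
  rw [← EReal.coe_mul]
  congr 1
  field_simp

lemma TailAssumption.satisfiesLDP (hX : TailAssumption P X α a b ν₁ ν₂) (hε : 0 < ε)
    (hε1 : ε ≠ 1) (r : ℕ) :
    SatisfiesLDP (fun N : ℕ => condLaw P X ε r N) (speed α) (rate α a b ε ν₁ ν₂ r) where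
  lowerSemicontinuous := lowerSemicontinuous_rate hX.α_pos hX.a_pos.le hX.b_pos.le hε
  monotone_speed := fun m n hmn => Real.rpow_le_rpow (Nat.cast_nonneg m)
    (Nat.cast_le.2 hmn) (by linarith [hX.α_pos])
  tendsto_speed := WignerLDP.tendsto_speed hX.α_pos
  lower_bound := by
    intro B _
    -- Each real `y` below `-inf` provides one point of the interior with rate less than `-y`, and a
    -- single ball around it gives the bound.
    refine EReal.ge_of_forall_gt_iff_ge.1 fun y hy => ?_
    have hy' := EReal.lt_neg_of_lt_neg hy
    rw [← EReal.coe_neg] at hy'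
    obtain ⟨x, hx⟩ : ∃ x ∈ interior B,
        ((rate α a b ε ν₁ ν₂ r x : ℝ≥0∞) : EReal) < ((-y : ℝ) : EReal) := by
      by_contra hcon
      push Not at hcon
      refine absurd hy' (not_lt.2 ?_)
      rcases le_total (-y) 0 with h0 | h0
      · exact (EReal.coe_nonpos.2 h0).trans (EReal.coe_ennreal_nonneg _)
      · have e : ((-y : ℝ) : EReal) = ((ENNReal.ofReal (-y) : ℝ≥0∞) : EReal) := by
          rw [EReal.coe_ennreal_ofReal, max_eq_left h0]
        rw [e, EReal.coe_ennreal_le_coe_ennreal_iff]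
        refine le_iInf₂ fun x hx => ?_
        rw [← EReal.coe_ennreal_le_coe_ennreal_iff, ← e]
        exact hcon x hx
    obtain ⟨hxB, hxy⟩ := hx
    have hxD : x ∈ proj '' domain ε ν₁ ν₂ r := by
      by_contra h
      rw [rate_eq_top h] at hxy
      simp at hxy
    obtain ⟨A, hA, hAb, rfl⟩ := exists_rep_inBlock hxD
    rw [rate_proj_eq hX.α_pos hX.a_pos.le hX.b_pos.le hA hAb, EReal.coe_lt_coe_iff] at hxy
    obtain ⟨δ, hδ, hball⟩ := Metric.mem_nhds_iff.1 (mem_interior_iff_mem_nhds.1 hxB)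
    refine le_liminf_of_le (by isBoundedDefault) ?_
    filter_upwards [hX.eventually_condLaw_ball_ge hε hε1 hA hAb hδ hxy,
      (WignerLDP.tendsto_speed hX.α_pos).eventually_gt_atTop 0] with N hN hv
    have := le_inv_mul_log hv (hN.trans (measure_mono hball))
    rwa [neg_neg] at this
  upper_bound := by
    intro B _
    -- Testing against real `y` also covers an infinite infimum, where the decay is faster than
    -- every exponential rate.
    refine EReal.le_of_forall_lt_iff_le.1 fun y hy => ?_
    have hy' := EReal.neg_lt_of_neg_lt hy
    rw [← EReal.coe_neg] at hy'
    refine limsup_le_of_le (by isBoundedDefault) ?_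
    filter_upwards [hX.eventually_condLaw_closure_le hε hε1 B hy',
      (WignerLDP.tendsto_speed hX.α_pos).eventually_gt_atTop 0] with N hN hv
    have := inv_mul_log_le hv hN
    rwa [neg_neg] at this

end conclusion

end WignerLDP

theorem mainTheorem8 {Ω : Type*} [MeasurableSpace Ω] (P : Measure Ω) [IsProbabilityMeasure P]
    (X : ℕ → ℕ → Ω → ℂ) (α a b : ℝ) (ν₁ ν₂ : Measure (Metric.sphere (0 : ℂ) 1))
    [IsProbabilityMeasure ν₁] [IsProbabilityMeasure ν₂]
    (hX : WignerLDP.TailAssumption P X α a b ν₁ ν₂)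
    (r : ℕ) (ε : ℝ) (hε : 0 < ε) (hε1 : ε ≠ 1) :
    WignerLDP.SatisfiesLDP (fun N : ℕ => WignerLDP.condLaw P X ε r N)
        (fun N : ℕ => (N : ℝ) ^ (α / 2)) (WignerLDP.rate α a b ε ν₁ ν₂ r) ∧
      WignerLDP.IsGood (WignerLDP.rate α a b ε ν₁ ν₂ r) :=
  ⟨hX.satisfiesLDP hε hε1 r, WignerLDP.isGood_rate hX.α_pos hX.a_pos.le hX.b_pos.le hε⟩
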